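/- Let $n\ge 2$ be an integer, $m$ a divisor of $n$, $G$ a subgroup of $S_n$, and $X$ a $G$-set with $n$ elements. Let $J=\ker(\mathbb Z[X]\to\mathbb Z/m\mathbb Z)$, where every $x\in X$ is mapped to $1$, with the induced action of $G$. Let $F$ be a field with $\operatorname{char}(F)\nmid n$, $F_{sep}$ a separable closure of $F$, and let $T=\operatorname{Spec}F[J]$ be the split torus with character group $J$, so that $T(R)=\operatorname{Hom}(J,R^\times)$ and $G$ acts on $T$ by $(gt)(j)=t(g^{-1}j)$. Write $H^1(F,T\rtimes G)=H^1(\operatorname{Gal}(F_{sep}/F),(T\rtimes G)(F_{sep}))$ for the set of classes of continuous $1$-cocycles, $G$ being a constant group. A Galois $G$-algebra over $F$ is an étale $F$-algebra $E$ of dimension $|G|$ with an action of $G$ by $F$-algebra automorphisms such that $E^G=F$. For such an $E$ let $E_X=\operatorname{Map}_G(X,E)=(E\otimes_F F^X)^G$ be the étale $F$-algebra of degree $n$ obtained by twisting $F^X$ by the $G$-torsor $\operatorname{Spec}E$. For a nonzero étale $F$-algebra $K$ let $\operatorname{Br}_m(K/F)=\ker(\operatorname{Br}_m(F)\to\operatorname{Br}(K))$,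 where $\operatorname{Br}_m(F)$ is the $m$-torsion subgroup of $\operatorname{Br}(F)$. Then there is a bijection \[H^{1}(F,T\rtimes G)\;\simeq\;\coprod_{E}\operatorname{Br}_{m}(E_X/F),\] where the disjoint union is taken over all isomorphism classes of Galois $G$-algebras $E$ over $F$. It sends the class of a cocycle $c=(t_\sigma,\gamma_\sigma)_\sigma$ to the Brauer class of the central simple $F$-algebra \[\{M\in M_X(F_{sep}) : t_\sigma(x-y)\,\sigma(M_{\gamma_\sigma^{-1}x,\,\gamma_\sigma^{-1}y})=M_{x,y}\ \text{for all }\sigma,x,y\}\] in the component of the Galois $G$-algebra $\{f\colon G\to F_{sep} : f(\gamma_\sigma h)=\sigma(f(h))\ \text{for all }\sigma,h\}$, on which $G$ acts by $(gf)(h)=f(hg)$. If $G$ acts simply transitively on $X$, then $\operatorname{Br}_m(E_X/F)=\operatorname{Br}_m(E/F)$ for every Galois $G$-algebra $E$ over $F$, so that $H^{1}(F,T\rtimes G)\simeq\coprod_{E}\operatorname{Br}_{m}(E/F)$. -/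

import Mathlib

universe u v w

open scoped TensorProduct

noncomputable section

namespace TorusBrauer

/-! ### Non-abelian Galois cohomology in degree one -/

section Cohomology

variable (Γ : Type u) [Group Γ] [TopologicalSpace Γ] (A : Type v) [Group A]
  [MulDistribMulAction Γ A]

/-- Continuous 1-cocycles of the topological group `Γ` with values in the discrete `Γ`-group `A`.
Continuity for the discrete topology on `A` is local constancy. -/
structure Cocycle where
  toFun : Γ → A
  map_mul' : ∀ σ τ, toFun (σ * τ) = toFun σ * σ • toFun τ
  locConst : IsLocallyConstant toFun

instance : CoeFun (Cocycle Γ A) (fun _ => Γ → A) := ⟨Cocycle.toFun⟩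

/-- Two cocycles are cohomologous if `c' σ = a⁻¹ * c σ * σ(a)` for some `a`. -/
def cohomologous : Setoid (Cocycle Γ A) where
  r c c' := ∃ a : A, ∀ σ : Γ, c' σ = a⁻¹ * c σ * σ • a
  iseqv :=
    { refl := fun c => ⟨1, fun σ => by simp⟩
      symm := by
        rintro c c' ⟨a, h⟩
        exact ⟨a⁻¹, fun σ => by rw [h]; simp [mul_assoc]⟩
      trans := by
        rintro c c' c'' ⟨a, h⟩ ⟨b, h'⟩
        exact ⟨a * b, fun σ => by rw [h', h]; simp [mul_assoc]⟩ }

/-- The pointed set `H¹(Γ, A)`. -/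
def H1 : Type (max u v) := Quotient (cohomologous Γ A)

/-- The cohomology class of a cocycle. -/
def H1.mk {Γ : Type u} [Group Γ] [TopologicalSpace Γ] {A : Type v} [Group A]
    [MulDistribMulAction Γ A] (c : Cocycle Γ A) : H1 Γ A := Quotient.mk (cohomologous Γ A) c

end Cohomology

/-- The absolute Galois group `Gal(F_sep/F)`, with its Krull topology. -/
abbrev AbsGal (F : Type u) [Field F] : Type u := Gal(SeparableClosure F/F)

/-! ### The lattice `J`, the split torus with character group `J`, and `T ⋊ G` -/

section Torus

variable (X : Type v) (m : ℕ)

/-- The map `ℤ[X] → ℤ/m` sending every `x ∈ X` to `1`. -/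
def augMod : (X →₀ ℤ) →+ ZMod m := Finsupp.liftAddHom fun _ => Int.castAddHom (ZMod m)

/-- `J = ker (ℤ[X] → ℤ/m)`. -/
def J : AddSubgroup (X →₀ ℤ) := (augMod X m).ker

/-- The element `x - y` of `J`. -/
def J.diff (x y : X) : J X m :=
  ⟨Finsupp.single x 1 - Finsupp.single y 1, by
    rw [J, AddMonoidHom.mem_ker, map_sub]; simp [augMod]⟩

variable {X} in
theorem J.diff_add (x y z : X) : J.diff X m x y + J.diff X m y z = J.diff X m x z := by
  ext1; simp [J.diff]

variable {X} in
theorem J.diff_self (x : X) : J.diff X m x x = 0 := by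
  ext1; simp [J.diff]

/-- The `R`-points of the split torus `T = Spec F[J]` with character group `J`, that is the group
`Hom(J, Rˣ)`; see `torusPointsEquiv`. -/
abbrev TorusPoints (R : Type w) [CommRing R] : Type (max v w) := Multiplicative (J X m) →* Rˣ

/-- The `F`-algebra homomorphisms `F[J] → R` are the homomorphisms `J → Rˣ`. -/
def torusPointsEquiv (F : Type u) [Field F] (R : Type w) [CommRing R] [Algebra F R] :
    (MonoidAlgebra F (Multiplicative (J X m)) →ₐ[F] R) ≃ TorusPoints X m R :=
  (MonoidAlgebra.lift F R (Multiplicative (J X m))).symm.trans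
    { toFun := fun f => f.toHomUnits
      invFun := fun f => (Units.coeHom R).comp f
      left_inv := fun f => by ext; rfl
      right_inv := fun f => by ext; rfl }

variable (G : Type w) [Group G] [MulAction G X]

variable {X G} in
/-- The action of `g ∈ G` on `J ⊆ ℤ[X]` induced by the action on `X`. -/
def J.act (g : G) : J X m →+ J X m :=
  ((Finsupp.mapDomain.addMonoidHom (g • · : X → X)).comp (J X m).subtype).codRestrict (J X m) (by
    rintro ⟨f, hf⟩
    have hf' : augMod X m f = 0 := hf
    change augMod X m _ = 0
    rw [← hf']
    simp only [augMod, AddMonoidHom.comp_apply, AddSubgroup.subtype_apply,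
      Finsupp.mapDomain.addMonoidHom_apply, Finsupp.liftAddHom_apply]
    rw [Finsupp.sum_mapDomain_index] <;> simp)

variable {X G} in
theorem J.coe_act (g : G) (j : J X m) :
    (J.act m g j : X →₀ ℤ) = Finsupp.mapDomain (g • ·) (j : X →₀ ℤ) := rfl

variable {X G} in
theorem J.act_one (j : J X m) : J.act m (1 : G) j = j := by
  ext1
  rw [J.coe_act, show ((1 : G) • · : X → X) = id from funext (one_smul G), Finsupp.mapDomain_id]

variable {X G} in
theorem J.act_mul (g h : G) (j : J X m) : J.act m (g * h) j = J.act m g (J.act m h j) := by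
  ext1
  simp only [J.coe_act, ← Finsupp.mapDomain_comp]
  congr 1
  funext x
  simp [mul_smul]

/-- The action of `G` on the points of `T`: `(g t)(j) = t(g⁻¹ j)`. -/
def torusAct (R : Type u) [CommRing R] : G →* MulAut (TorusPoints X m R) where
  toFun g :=
    { toFun := fun t => t.comp (AddMonoidHom.toMultiplicative (J.act m g⁻¹))
      invFun := fun t => t.comp (AddMonoidHom.toMultiplicative (J.act m g))
      left_inv := fun t => by
        ext j
        simp [← J.act_mul, J.act_one]
      right_inv := fun t => by
        ext j
        simp [← J.act_mul, J.act_one]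
      map_mul' := fun t t' => rfl }
  map_one' := by
    ext t j
    simp [J.act_one]
  map_mul' g h := by
    ext t j
    simp [J.act_mul]

/-- The `R`-points of `T ⋊ G`, for `R` with connected spectrum (only fields are used), where `G` is
regarded as a constant group. -/
abbrev TorusSemidirect (R : Type u) [CommRing R] : Type _ :=
  TorusPoints X m R ⋊[torusAct X m G R] G

/-- `Gal(F_sep/F)` acts on `(T ⋊ G)(F_sep)` through `F_sep`; so the action on `G` is trivial. -/
instance (F : Type u) [Field F] :
    MulDistribMulAction (AbsGal F) (TorusSemidirect X m G (SeparableClosure F)) where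
  smul σ p := ⟨(Units.map (σ : SeparableClosure F →* SeparableClosure F)).comp p.left, p.right⟩
  one_smul p := by
    refine SemidirectProduct.ext ?_ rfl
    ext j; rfl
  mul_smul σ τ p := by
    refine SemidirectProduct.ext ?_ rfl
    ext j; rfl
  smul_mul σ p q := by
    refine SemidirectProduct.ext ?_ rfl
    exact MonoidHom.comp_mul _ _ _
  smul_one σ := by
    refine SemidirectProduct.ext ?_ rfl
    exact MonoidHom.comp_one _

theorem smul_left (F : Type u) [Field F] (σ : AbsGal F)
    (p : TorusSemidirect X m G (SeparableClosure F)) : (σ • p).left =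
      (Units.map (σ : SeparableClosure F →* SeparableClosure F)).comp p.left := rfl

theorem smul_right (F : Type u) [Field F] (σ : AbsGal F)
    (p : TorusSemidirect X m G (SeparableClosure F)) : (σ • p).right = p.right := rfl

end Torus

/-! ### Galois `G`-algebras -/

section GaloisAlgebras

variable (G : Type w) [Group G] (F : Type u) [Field F]

/-- A Galois `G`-algebra over `F`: an étale `F`-algebra `E` of dimension `|G|` on which `G` acts by
`F`-algebra automorphisms with `E^G = F`. -/
structure GaloisAlgebra where
  carrier : Type u
  [commRing : CommRing carrier]
  [algebra : Algebra F carrier]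
  [action : MulSemiringAction G carrier]
  [smulComm : SMulCommClass G F carrier]
  [etale : Algebra.Etale F carrier]
  finrank_eq : Module.finrank F carrier = Nat.card G
  [invariant : Algebra.IsInvariant F carrier G]

instance : CoeSort (GaloisAlgebra G F) (Type u) := ⟨GaloisAlgebra.carrier⟩

attribute [instance] GaloisAlgebra.commRing GaloisAlgebra.algebra GaloisAlgebra.action
  GaloisAlgebra.smulComm GaloisAlgebra.etale GaloisAlgebra.invariant

/-- Galois `G`-algebras are isomorphic if there is a `G`-equivariant `F`-algebra isomorphism. -/
def galoisIso : Setoid (GaloisAlgebra G F) where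
  r E E' := ∃ e : E ≃ₐ[F] E', ∀ (g : G) (x : E), e (g • x) = g • e x
  iseqv :=
    { refl := fun E => ⟨AlgEquiv.refl, fun _ _ => rfl⟩
      symm := by
        rintro E E' ⟨e, he⟩
        exact ⟨e.symm, fun g x => by rw [AlgEquiv.symm_apply_eq, he, e.apply_symm_apply]⟩
      trans := by
        rintro E E' E'' ⟨e, he⟩ ⟨e', he'⟩
        exact ⟨e.trans e', fun g x => by simp [he, he']⟩ }

/-- Isomorphism classes of Galois `G`-algebras over `F`. -/
def GaloisClass : Type _ := Quotient (galoisIso G F)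

variable {G F} in
/-- The isomorphism class of a Galois `G`-algebra. -/
def GaloisClass.mk (E : GaloisAlgebra G F) : GaloisClass G F := Quotient.mk (galoisIso G F) E

variable {G F} in
/-- For a Galois `G`-algebra `E` and a `G`-set `X`, the algebra `Map_G(X, E) = (E ⊗ F^X)^G` of
`G`-equivariant maps `X → E`, that is the form of `F^X` obtained by twisting with the `G`-torsor
`Spec E`. -/
def assocAlgebra (X : Type v) [MulAction G X] (E : GaloisAlgebra G F) : Subalgebra F (X → E) where
  carrier := {φ | ∀ (g : G) (x : X), φ (g • x) = g • φ x}
  mul_mem' := fun {φ ψ} hφ hψ g x => by simp [hφ g x, hψ g x]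
  add_mem' := fun {φ ψ} hφ hψ g x => by simp [hφ g x, hψ g x]
  algebraMap_mem' r g x := by simp

end GaloisAlgebras

/-! ### Relative Brauer groups -/

section Brauer

/-- A `K`-algebra is split if it is a full matrix algebra over `K`. -/
def IsSplit (K : Type u) [CommRing K] (B : Type v) [Ring B] [Algebra K B] : Prop :=
  ∃ d : ℕ, d ≠ 0 ∧ Nonempty (B ≃ₐ[K] Matrix (Fin d) (Fin d) K)

/-- `Br_m(K/F) = ker (Br_m(F) → Br(K))` for an étale `F`-algebra `K ≠ 0`, as a subset of `Br(F)`: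
the classes of central simple `F`-algebras `A` whose `m`-th tensor power is split and which are
split by `K`. -/
def relBrauer (m : ℕ) (F : Type u) [Field F] (K : Type v) [CommRing K] [Algebra F K] :
    Set (BrauerGroup.{u, u} F) :=
  {b | ∃ A : CSA.{u, u} F, Quotient.mk (Brauer.CSA_Setoid F) A = b ∧
    IsSplit F (⨂[F] _ : Fin m, A) ∧ IsSplit K (K ⊗[F] A)}

theorem relBrauer_mono (m : ℕ) (F : Type u) [Field F] {K : Type v} [CommRing K] [Algebra F K]
    {K' : Type w} [CommRing K'] [Algebra F K'] (e : K ≃ₐ[F] K') :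
    relBrauer m F K ⊆ relBrauer m F K' := by
  rintro b ⟨A, hA, hm, d, hd, ⟨f⟩⟩
  refine ⟨A, hA, hm, d, hd, ⟨?_⟩⟩
  let f' : K' ⊗[F] A ≃+* Matrix (Fin d) (Fin d) K' :=
    ((Algebra.TensorProduct.congr e.symm (AlgEquiv.refl (A₁ := A))).toRingEquiv.trans
      f.toRingEquiv).trans e.toRingEquiv.mapMatrix
  refine AlgEquiv.ofRingEquiv (f := f') fun k => ?_
  have h : f ((e.symm k) ⊗ₜ[F] (1 : A)) = algebraMap K _ (e.symm k) := f.commutes (e.symm k)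
  change (f ((e.symm k) ⊗ₜ[F] (1 : A))).map e = _
  rw [h]
  ext i j
  by_cases hij : i = j
  · subst hij; simp [Matrix.algebraMap_matrix_apply]
  · simp [Matrix.algebraMap_matrix_apply, hij]

theorem relBrauer_congr (m : ℕ) (F : Type u) [Field F] {K : Type v} [CommRing K] [Algebra F K]
    {K' : Type w} [CommRing K'] [Algebra F K'] (e : K ≃ₐ[F] K') :
    relBrauer m F K = relBrauer m F K' :=
  (relBrauer_mono m F e).antisymm (relBrauer_mono m F e.symm)

variable {G : Type w} [Group G] {F : Type u} [Field F] (X : Type v) [MulAction G X]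

/-- An isomorphism of Galois `G`-algebras induces one of the associated algebras. -/
def assocAlgebraEquiv {E E' : GaloisAlgebra G F} (e : E ≃ₐ[F] E')
    (he : ∀ (g : G) (x : E), e (g • x) = g • e x) :
    assocAlgebra X E ≃ₐ[F] assocAlgebra X E' where
  toFun φ := ⟨fun x => e (φ.1 x), fun g x => by
    beta_reduce
    rw [show φ.1 (g • x) = g • φ.1 x from φ.2 g x, he]⟩
  invFun φ := ⟨fun x => e.symm (φ.1 x), fun g x => by
    beta_reduce
    rw [show φ.1 (g • x) = g • φ.1 x from φ.2 g x, AlgEquiv.symm_apply_eq, he,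
      e.apply_symm_apply]⟩
  left_inv φ := by ext x; simp
  right_inv φ := by ext x; simp
  map_mul' φ ψ := by ext x; simp
  map_add' φ ψ := by ext x; simp
  commutes' r := by ext x; exact e.commutes r

/-- `Br_m(Map_G(X, E)/F)` as a function of the isomorphism class of `E`. -/
def relBrauerClass (m : ℕ) : GaloisClass G F → Set (BrauerGroup.{u, u} F) :=
  Quotient.lift (fun E => relBrauer m F (assocAlgebra X E)) fun _ _ ⟨e, he⟩ =>
    relBrauer_congr m F (assocAlgebraEquiv X e he)

end Brauer

/-! ### The objects attached to a cocycle -/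

section Twist

variable {F : Type u} [Field F] {G : Type w} [Group G] {X : Type v} [MulAction G X] {m : ℕ}

/-- The Galois `G`-algebra attached to the image `γ` of a cocycle `c` in `Z¹(F, G)`: the maps
`f : G → F_sep` with `f(γ_σ h) = σ(f(h))`, that is the invariants in `Map(G, F_sep)` of the Galois
action twisted by left translations. The group `G` acts on it by right translations. -/
def twistGalois (c : Cocycle (AbsGal F) (TorusSemidirect X m G (SeparableClosure F))) :
    Subalgebra F (G → SeparableClosure F) where
  carrier := {f | ∀ (σ : AbsGal F) (h : G), f ((c σ).right * h) = σ (f h)}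
  mul_mem' := fun {f f'} hf hf' σ h => by simp [hf σ h, hf' σ h]
  add_mem' := fun {f f'} hf hf' σ h => by simp [hf σ h, hf' σ h]
  algebraMap_mem' r σ h := by simp

variable [Fintype X] [DecidableEq X]

/-- The action of `(t, g) ∈ (T ⋊ G)(R)` on `M_X(R)` through
`T ⋊ G = (𝔾_m^X / μ_m) ⋊ G → PGL_X`: conjugation by the diagonal matrix of a lift of `t` times the
permutation matrix of `g`. -/
def adMatrix {R : Type u} [CommRing R] (p : TorusSemidirect X m G R) (M : Matrix X X R) :
    Matrix X X R :=
  Matrix.of fun x y => (p.left (Multiplicative.ofAdd (J.diff X m x y)) : R) *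
    M (p.right⁻¹ • x) (p.right⁻¹ • y)

/-- The form of `M_X(F)` attached to a cocycle `c`: the invariants in `M_X(F_sep)` of the Galois
action twisted by `c`. -/
def twistMatrix (c : Cocycle (AbsGal F) (TorusSemidirect X m G (SeparableClosure F))) :
    Subalgebra F (Matrix X X (SeparableClosure F)) where
  carrier := {M | ∀ σ : AbsGal F, adMatrix (c σ) (M.map σ) = M}
  mul_mem' := by
    intro M N hM hN σ
    refine Matrix.ext fun x y => ?_
    have h1 := fun z => (congrFun (congrFun (hM σ) x) z).symm
    have h2 := fun z => (congrFun (congrFun (hN σ) z) y).symm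
    simp only [adMatrix, Matrix.of_apply, Matrix.map_apply] at h1 h2
    simp only [adMatrix, Matrix.of_apply, Matrix.map_apply, Matrix.mul_apply, map_sum, map_mul]
    rw [Finset.mul_sum]
    refine Fintype.sum_equiv (MulAction.toPerm (c σ).right) _ _ fun z => ?_
    rw [MulAction.toPerm_apply, h1, h2, inv_smul_smul]
    rw [← J.diff_add m x ((c σ).right • z) y, ofAdd_add, map_mul, Units.val_mul]
    ring
  add_mem' := by
    intro M N hM hN σ
    refine Matrix.ext fun x y => ?_
    have h1 := congrFun (congrFun (hM σ) x) y
    have h2 := congrFun (congrFun (hN σ) x) y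
    simp only [adMatrix, Matrix.of_apply, Matrix.map_apply] at h1 h2
    simp only [adMatrix, Matrix.of_apply, Matrix.map_apply, Matrix.add_apply, map_add, mul_add,
      h1, h2]
  algebraMap_mem' := by
    intro r σ
    refine Matrix.ext fun x y => ?_
    by_cases hxy : x = y
    · subst hxy
      simp [adMatrix, Matrix.algebraMap_matrix_apply, J.diff_self]
    · simp [adMatrix, Matrix.algebraMap_matrix_apply, hxy]

end Twist

end TorusBrauer

end

open TorusBrauer

/-!
A cocycle of `T ⋊ G` acts on `M_X(F_sep)` through `PGL_X`, by products of a diagonal and a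
permutation matrix. Its `G`-component is a continuous homomorphism `γ` from the Galois group to
`G`, which is the same thing as a Galois `G`-algebra `E`. Lifting the action from `PGL_X` to `GL_X`
produces a factor set, and by Skolem–Noether and Hilbert 90 two central simple algebras are Brauer
equivalent exactly when their factor sets are cohomologous.

Fix `z : X`. The functions `x ↦ t_σ(x - z)` on `X` have the factor set as coboundary for the action
twisted by `γ`, so that `E_X` splits the algebra, while the `t_σ(m z)` show that the `m`-th power of
the factor set is a coboundary. Conversely, a splitting over `E_X` provides functions
`u_σ : X → F_sepˣ` whose coboundary is the factor set. As `m` is invertible in `F`, the field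
`F_sep` is closed under `m`-th roots, so that an `m`-torsion factor set can be rescaled until its
`m`-th power is `1`; then the `u_σ`, modulo `μ_m`, give points of `T = 𝔾_m^X / μ_m`. Injectivity is
Hilbert 90 for the torus of units of `E_X`.
-/

noncomputable section

namespace TorusBrauer

/-! ### Galois descent for vector spaces -/

section Descent

open Topology

variable {F L : Type*} [Field F] [Field L] [Algebra F L]

/-- A continuous semilinear action of `Gal(L/F)` on an `L`-vector space; continuity means that
stabilizers are open. -/
structure SemilinearAction (F L V : Type*) [Field F] [Field L] [Algebra F L] [AddCommGroup V]
    [Module L V] where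
  toFun : Gal(L/F) → V →+ V
  map_smul' : ∀ σ (a : L) v, toFun σ (a • v) = σ a • toFun σ v
  map_mul' : ∀ σ τ v, toFun (σ * τ) v = toFun σ (toFun τ v)
  eventually_fixed : ∀ v, ∀ᶠ σ in 𝓝 1, toFun σ v = v

namespace SemilinearAction

variable {V : Type*} [AddCommGroup V] [Module L V] (ρ : SemilinearAction F L V)

instance : CoeFun (SemilinearAction F L V) (fun _ => Gal(L/F) → V →+ V) := ⟨toFun⟩

theorem map_one (v : V) : ρ 1 v = v := (ρ.eventually_fixed v).self_of_nhds

/-- The stabilizer of a vector. -/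
def stabilizer (v : V) : Subgroup Gal(L/F) where
  carrier := {σ | ρ σ v = v}
  mul_mem' {σ τ} hσ hτ := by
    rw [Set.mem_ofPred_eq] at *
    rw [ρ.map_mul', hτ, hσ]
  one_mem' := ρ.map_one v
  inv_mem' {σ} hσ := by
    rw [Set.mem_ofPred_eq] at *
    conv_lhs => rw [← hσ, ← ρ.map_mul', inv_mul_cancel, ρ.map_one]

theorem mem_stabilizer {v : V} {σ : Gal(L/F)} : σ ∈ ρ.stabilizer v ↔ ρ σ v = v := Iff.rfl

theorem isOpen_stabilizer (v : V) : IsOpen (ρ.stabilizer v : Set Gal(L/F)) :=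
  Subgroup.isOpen_of_mem_nhds _ (ρ.eventually_fixed v)

theorem apply_smul_eq_of_mk_eq {v : V} {σ τ : Gal(L/F)}
    (h : (σ : Gal(L/F) ⧸ ρ.stabilizer v) = τ)
    (a : IntermediateField.fixedField (ρ.stabilizer v)) :
    ρ σ ((a : L) • v) = ρ τ ((a : L) • v) := by
  have hmem : σ⁻¹ * τ ∈ ρ.stabilizer v := QuotientGroup.eq.1 h
  have ha : (σ⁻¹ * τ) (a : L) = a := a.2 ⟨_, hmem⟩
  conv_rhs => rw [← mul_inv_cancel_left σ τ, ρ.map_mul', ρ.map_smul', ρ.mem_stabilizer.1 hmem, ha]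

variable [Module F V] [IsScalarTower F L V]

/-- The `F`-space of invariant vectors. -/
def invariants : Submodule F V where
  carrier := {v | ∀ σ, ρ σ v = v}
  add_mem' hv hw σ := by rw [map_add, hv, hw]
  zero_mem' σ := map_zero _
  smul_mem' a v hv σ := by
    rw [← algebraMap_smul L a v, ρ.map_smul', AlgEquiv.commutes, hv]

theorem sum_out_smul_mem_invariants (v : V) [Fintype (Gal(L/F) ⧸ ρ.stabilizer v)]
    (a : IntermediateField.fixedField (ρ.stabilizer v)) :
    ∑ q : Gal(L/F) ⧸ ρ.stabilizer v, ρ q.out ((a : L) • v) ∈ ρ.invariants := by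
  intro τ
  simp only [map_sum, ← ρ.map_mul']
  refine Fintype.sum_equiv (MulAction.toPerm τ) _ _ fun q => ρ.apply_smul_eq_of_mk_eq ?_ a
  rw [MulAction.toPerm_apply, QuotientGroup.out_eq']
  exact congrArg (τ • ·) (QuotientGroup.out_eq' q)

variable [IsGalois F L]

theorem mem_range_algebraMap_of_sum_mem_invariants {ι : Type*} {v : ι → V}
    (hv : ∀ i, v i ∈ ρ.invariants) {s : Finset ι} (hs : LinearIndepOn L v (s : Set ι)) {c : ι → L}
    (hc : ∑ i ∈ s, c i • v i ∈ ρ.invariants) {i : ι} (hi : i ∈ s) :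
    c i ∈ Set.range (algebraMap F L) := by
  refine (InfiniteGalois.mem_range_algebraMap_iff_fixed _).2 fun σ => ?_
  have hσ : ∑ i ∈ s, (σ (c i) - c i) • v i = 0 := by
    have h := hc σ
    simp only [map_sum, ρ.map_smul', (hv _) σ] at h
    simp only [sub_smul, Finset.sum_sub_distrib, h, sub_self]
  exact sub_eq_zero.1 (linearIndepOn_finset_iff.1 hs _ hσ i hi)

theorem linearIndependent_of_invariant {ι : Type*} {v : ι → V} (hv : ∀ i, v i ∈ ρ.invariants)
    (h : LinearIndependent F v) : LinearIndependent L v := by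
  classical
  refine linearIndependent_iff_finset_linearIndependent.2 fun s => ?_
  change LinearIndepOn L v (s : Set ι)
  induction s using Finset.induction_on with
  | empty => simp
  | insert a s has ih =>
    rw [Finset.coe_insert, linearIndepOn_insert (by exact_mod_cast has)]
    refine ⟨ih, fun ha => ?_⟩
    obtain ⟨c, hc⟩ := (Submodule.mem_span_image_finset_iff_exists_fun' L).1 ha
    have hF (i : ι) (hi : i ∈ s) : ∃ r : F, algebraMap F L r = c i :=
      ρ.mem_range_algebraMap_of_sum_mem_invariants hv ih (hc ▸ hv a) hi
    choose! r hr using hF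
    have haF : v a ∈ Submodule.span F (v '' s) :=
      (Submodule.mem_span_image_finset_iff_exists_fun' F).2 ⟨r, by
        rw [← hc]
        exact Finset.sum_congr rfl fun i hi => by rw [← hr i hi, algebraMap_smul]⟩
    exact h.notMem_span_image (by exact_mod_cast has) haF

theorem injective_restrict_out (U : Subgroup Gal(L/F)) (hU : IsClosed (U : Set Gal(L/F))) :
    Function.Injective fun q : Gal(L/F) ⧸ U =>
      ((q.out : Gal(L/F)) : L →* L).comp
        ((IntermediateField.fixedField U).val : IntermediateField.fixedField U →* L) := by
  intro q q' h
  rw [← QuotientGroup.out_eq' q, ← QuotientGroup.out_eq' q', QuotientGroup.eq]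
  refine (InfiniteGalois.fixingSubgroup_fixedField ⟨U, hU⟩).le
    ((IntermediateField.mem_fixingSubgroup_iff _ _).2 fun a ha => ?_)
  have hqq' : q.out a = q'.out a := DFunLike.congr_fun h ⟨a, ha⟩
  rw [AlgEquiv.mul_apply, ← hqq']
  exact q.out.symm_apply_apply a

/-- The sums of `q (a • v)` over the cosets `q` of the stabilizer of `v` are invariant for all `a`
in its fixed field, so by the independence of characters a functional that kills them kills `v`. -/
theorem span_invariants : Submodule.span L (ρ.invariants : Set V) = ⊤ := by
  rw [eq_top_iff]
  intro v _
  by_contra hv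
  obtain ⟨f, hfv, hf⟩ := Submodule.exists_le_ker_of_notMem hv
  have : Finite (Gal(L/F) ⧸ ρ.stabilizer v) :=
    Subgroup.quotient_finite_of_isOpen _ (ρ.isOpen_stabilizer v)
  have : Fintype (Gal(L/F) ⧸ ρ.stabilizer v) := Fintype.ofFinite _
  have hindep := (linearIndependent_monoidHom _ L).comp _ (injective_restrict_out _
    (Subgroup.isClosed_of_isOpen _ (ρ.isOpen_stabilizer v)))
  obtain ⟨τ, hτ⟩ := QuotientGroup.mk_out_eq_mul (ρ.stabilizer v) 1
  have hone : ρ (QuotientGroup.mk (s := ρ.stabilizer v) 1).out v = v := by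
    rw [hτ, one_mul]
    exact τ.2
  apply hfv
  rw [← hone]
  refine Fintype.linearIndependent_iff.1 hindep (fun q => f (ρ q.out v)) (funext fun a => ?_) _
  have hzero := hf (Submodule.subset_span (ρ.sum_out_smul_mem_invariants v a))
  rw [LinearMap.mem_ker, map_sum] at hzero
  rw [Pi.zero_apply, ← hzero, Finset.sum_apply]
  refine Finset.sum_congr rfl fun q _ => ?_
  rw [ρ.map_smul', map_smul]
  exact mul_comm _ _

/-- An `F`-basis of the invariants is an `L`-basis of the whole space. -/
def basisOfInvariants {ι : Type*} (b : Module.Basis ι F ρ.invariants) : Module.Basis ι L V :=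
  Module.Basis.mk (v := fun i => (b i : V))
    (ρ.linearIndependent_of_invariant (fun i => (b i).2)
      (b.linearIndependent.map' ρ.invariants.subtype (Submodule.ker_subtype _)))
    (by
      rw [← ρ.span_invariants, ← Submodule.span_span_of_tower F L (Set.range _)]
      refine Submodule.span_mono fun v hv => ?_
      have h := Submodule.mem_map_of_mem (f := ρ.invariants.subtype) (b.mem_span ⟨v, hv⟩)
      rwa [Submodule.map_span, ← Set.range_comp] at h)

theorem finrank_invariants : Module.finrank F ρ.invariants = Module.finrank L V := by
  let b := Module.Basis.ofVectorSpace F ρ.invariants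
  rw [Module.finrank_eq_nat_card_basis b, Module.finrank_eq_nat_card_basis (ρ.basisOfInvariants b)]

theorem finite_invariants [Module.Finite L V] : Module.Finite F ρ.invariants := by
  let b := Module.Basis.ofVectorSpace F ρ.invariants
  have := Module.Finite.finite_basis (ρ.basisOfInvariants b)
  exact Module.Finite.of_basis b

end SemilinearAction

theorem eventually_apply_eq [Algebra.IsIntegral F L] (a : L) :
    ∀ᶠ σ : Gal(L/F) in 𝓝 1, σ a = a :=
  (stabilizer_isOpen_of_isIntegral a).mem_nhds (one_mem (MulAction.stabilizer _ a))

end Descent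

/-! ### Forms of algebras over an extension field -/

section ExtendScalars

variable {F L S R : Type*} [Field F] [CommRing L] [Algebra F L] [Ring S] [Algebra F S]
  [Ring R] [Algebra F R] [Algebra L R] [IsScalarTower F L R]

variable (L) in
/-- The `L`-linear extension `L ⊗ S → R` of a homomorphism `S → R`. -/
def extendScalars (f : S →ₐ[F] R) : L ⊗[F] S →ₐ[L] R :=
  Algebra.TensorProduct.lift (Algebra.ofId L R) f fun a _ => Algebra.commutes a _

theorem extendScalars_tmul (f : S →ₐ[F] R) (a : L) (s : S) :
    extendScalars L f (a ⊗ₜ s) = a • f s := by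
  rw [Algebra.smul_def]
  exact Algebra.TensorProduct.lift_tmul _ _ _ _ _

end ExtendScalars

section Forms

variable {F L S R : Type*} [Field F] [Field L] [Algebra F L] [Ring S] [Algebra F S]
  [Ring R] [Algebra F R] [Algebra L R] [IsScalarTower F L R]

variable (L) in
/-- The homomorphism `f` makes `S` an `F`-form of the `L`-algebra `R`. -/
def IsForm (f : S →ₐ[F] R) : Prop := Function.Bijective (extendScalars L f)

theorem range_extendScalars (f : S →ₐ[F] R) :
    LinearMap.range (extendScalars L f).toLinearMap = Submodule.span L (Set.range f) := by
  refine le_antisymm ?_ (Submodule.span_le.2 ?_)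
  · rintro _ ⟨z, rfl⟩
    induction z with
    | zero => exact zero_mem _
    | add x y hx hy => rw [map_add]; exact add_mem hx hy
    | tmul a s =>
      rw [AlgHom.toLinearMap_apply, extendScalars_tmul]
      exact Submodule.smul_mem _ _ (Submodule.subset_span ⟨s, rfl⟩)
  · rintro _ ⟨s, rfl⟩
    exact ⟨1 ⊗ₜ s, by simp [extendScalars_tmul]⟩

theorem isForm_of_span [Module.Finite F S] (f : S →ₐ[F] R)
    (hf : Submodule.span L (Set.range f) = ⊤) (hd : Module.finrank F S = Module.finrank L R) :
    IsForm L f := by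
  have hs : Function.Surjective (extendScalars L f).toLinearMap := by
    rw [← LinearMap.range_eq_top, range_extendScalars, hf]
  have : Module.Finite L R := Module.Finite.of_surjective _ hs
  exact ⟨(LinearMap.injective_iff_surjective_of_finrank_eq_finrank
    (by rw [Module.finrank_baseChange, hd])).2 hs, hs⟩

theorem isForm_ofId : IsForm L (Algebra.ofId F L) := by
  refine isForm_of_span _ (eq_top_iff.2 fun a _ => ?_) (by simp)
  rw [← mul_one a, ← smul_eq_mul]
  exact Submodule.smul_mem _ _ (Submodule.subset_span ⟨1, map_one _⟩)

namespace IsForm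

variable {f : S →ₐ[F] R} (hf : IsForm L f)

include hf

theorem span_range : Submodule.span L (Set.range f) = ⊤ := by
  rw [← range_extendScalars, LinearMap.range_eq_top]
  exact hf.2

theorem map_mem {V : Type*} [AddCommGroup V] [Module L V] (φ : R →ₗ[L] V) {W : Submodule L V}
    (h : ∀ s, φ (f s) ∈ W) (r : R) : φ r ∈ W := by
  have hle : Submodule.span L (Set.range f) ≤ W.comap φ :=
    Submodule.span_le.2 (Set.range_subset_iff.2 h)
  exact hle (hf.span_range ▸ Submodule.mem_top)

theorem mem_center {r : R} (h : ∀ s, f s * r = r * f s) : r ∈ Subalgebra.center L R :=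
  Subalgebra.mem_center_iff.2 fun r' => sub_eq_zero.1 <|
    hf.map_mem (LinearMap.mulRight L r - LinearMap.mulLeft L r) (W := ⊥)
      (fun s => sub_eq_zero.2 (h s)) r'

theorem finrank_eq : Module.finrank F S = Module.finrank L R := by
  rw [← Module.finrank_baseChange (R := L) (M' := S)]
  exact (LinearEquiv.ofBijective (extendScalars L f).toLinearMap hf).finrank_eq

theorem injective : Function.Injective f := by
  intro s s' h
  have heq : (1 : L) ⊗ₜ[F] s = 1 ⊗ₜ s' := hf.1 (by simp [extendScalars_tmul, h])
  exact Algebra.TensorProduct.includeRight_injective (FaithfulSMul.algebraMap_injective F L) heq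

/-- The isomorphism `L ⊗ S ≃ R` attached to a form. -/
def algEquiv : L ⊗[F] S ≃ₐ[L] R := AlgEquiv.ofBijective _ hf

theorem algEquiv_tmul (s : S) (a : L) : hf.algEquiv (a ⊗ₜ s) = a • f s := extendScalars_tmul f a s

/-- An `F`-basis of a form is an `L`-basis. -/
def basis {κ : Type*} (b : Module.Basis κ F S) : Module.Basis κ L R :=
  (Algebra.TensorProduct.basis L b).map hf.algEquiv.toLinearEquiv

theorem basis_apply {κ : Type*} (b : Module.Basis κ F S) (i : κ) : hf.basis b i = f (b i) := by
  simp [basis, algEquiv_tmul]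

theorem comp_algEquiv {R' : Type*} [Ring R'] [Algebra F R'] [Algebra L R'] [IsScalarTower F L R']
    (e : R ≃ₐ[L] R') : IsForm L ((e.restrictScalars F : R →ₐ[F] R').comp f) := by
  have h : extendScalars L ((e.restrictScalars F : R →ₐ[F] R').comp f) =
      (e : R →ₐ[L] R').comp (extendScalars L f) := by
    ext s
    simp [extendScalars_tmul]
  rw [IsForm, h]
  exact e.bijective.comp hf

theorem comp_algEquiv_left {S' : Type*} [Ring S'] [Algebra F S'] (e : S' ≃ₐ[F] S) :
    IsForm L (f.comp (e : S' →ₐ[F] S)) := by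
  have h : extendScalars L (f.comp (e : S' →ₐ[F] S)) = (extendScalars L f).comp
      (Algebra.TensorProduct.congr (AlgEquiv.refl (R := L) (A₁ := L)) e : _ →ₐ[L] _) := by
    ext s
    simp [extendScalars_tmul]
  rw [IsForm, h]
  exact hf.comp (AlgEquiv.bijective _)

theorem isSimpleRing [IsSimpleRing R] : IsSimpleRing S := by
  have : IsSimpleRing (L ⊗[F] S) := IsSimpleRing.of_ringEquiv hf.algEquiv.symm.toRingEquiv ‹_›
  have : Nontrivial S := f.toRingHom.domain_nontrivial
  refine IsSimpleRing.of_eq_bot_or_eq_top fun I => or_iff_not_imp_right.2 fun hI => ?_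
  have hinj {T : Type _} [Ring T] [Algebra F T] :
      Function.Injective (Algebra.TensorProduct.includeRight : T →ₐ[F] L ⊗[F] T) :=
    Algebra.TensorProduct.includeRight_injective (FaithfulSMul.algebraMap_injective F L)
  have : Nontrivial I.ringCon.Quotient := by
    refine ⟨0, 1, fun h => hI ((TwoSidedIdeal.one_mem_iff I).1 ?_)⟩
    exact (TwoSidedIdeal.mem_iff _ _).2 (I.ringCon.symm ((RingCon.eq _).1 h))
  have : Nontrivial (L ⊗[F] I.ringCon.Quotient) := hinj.nontrivial
  have hquot : Function.Injective (Algebra.TensorProduct.map (AlgHom.id L L) (I.ringCon.mkₐ F)) :=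
    RingHom.injective (Algebra.TensorProduct.map (AlgHom.id L L) (I.ringCon.mkₐ F)).toRingHom
  have hmk : Function.Injective (I.ringCon.mkₐ F) := fun s s' h =>
    hinj (hquot (by simp [h]))
  rw [← TwoSidedIdeal.ker_ringCon_mk' I, TwoSidedIdeal.ker_eq_bot]
  exact hmk

theorem isCentral [Nontrivial R] [Algebra.IsCentral L R] : Algebra.IsCentral F S := by
  refine ⟨fun z hz => ?_⟩
  have : Nontrivial S := f.toRingHom.domain_nontrivial
  obtain ⟨a, ha⟩ := (Algebra.IsCentral.mem_center_iff L).1 <| hf.mem_center (r := f z) fun s => by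
    rw [← map_mul, ← map_mul, Subalgebra.mem_center_iff.1 hz]
  have htmul : a ⊗ₜ[F] (1 : S) = 1 ⊗ₜ z := hf.1 (by
    rw [extendScalars_tmul, extendScalars_tmul, ha, map_one, one_smul, Algebra.smul_def, mul_one])
  obtain ⟨φ, hφ⟩ := Module.Projective.exists_dual_eq_one F (one_ne_zero (α := S))
  have haF := congrArg (TensorProduct.rid F L ∘ LinearMap.lTensor L φ) htmul
  simp only [Function.comp_apply, LinearMap.lTensor_tmul, TensorProduct.rid_tmul, hφ,
    one_smul] at haF
  refine ⟨φ z, hf.injective ?_⟩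
  change f (algebraMap F S (φ z)) = f z
  rw [ha, haF, AlgHom.commutes, ← Algebra.algebraMap_eq_smul_one, ← IsScalarTower.algebraMap_apply]

end IsForm

end Forms

/-! ### Forms of matrix algebras -/

section MatrixForms

open Matrix
open scoped Kronecker

variable {F L S S' : Type*} [Field F] [Field L] [Algebra F L] [Ring S] [Algebra F S]
  [Ring S'] [Algebra F S'] {ι κ : Type*} [Fintype ι] [DecidableEq ι] [Fintype κ] [DecidableEq κ]

theorem isForm_matrix_of_span [Module.Finite F S] (f : S →ₐ[F] Matrix ι ι L)
    (hf : Submodule.span L (Set.range f) = ⊤) (hd : Module.finrank F S = Fintype.card ι ^ 2) :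
    IsForm L f :=
  isForm_of_span f hf (by rw [hd, Module.finrank_matrix, Module.finrank_self, mul_one, sq])

theorem IsForm.finrank_matrix {f : S →ₐ[F] Matrix ι ι L} (hf : IsForm L f) :
    Module.finrank F S = Fintype.card ι ^ 2 := by
  rw [hf.finrank_eq, Module.finrank_matrix, Module.finrank_self, mul_one, sq]

theorem exists_conj_of_algEquiv (e : Matrix κ κ L ≃ₐ[L] Matrix ι ι L) :
    ∃ (P : Matrix ι κ L) (Q : Matrix κ ι L), P * Q = 1 ∧ Q * P = 1 ∧
      ∀ M, e M * P = P * M := by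
  let e' : Module.End L (κ → L) ≃ₐ[L] Module.End L (ι → L) :=
    (Matrix.toLinAlgEquiv' (R := L) (n := κ)).symm.trans
      (e.trans (Matrix.toLinAlgEquiv' (R := L) (n := ι)))
  obtain ⟨T, hT⟩ := e'.eq_linearEquivConjAlgEquiv
  refine ⟨LinearMap.toMatrix' T.toLinearMap, LinearMap.toMatrix' T.symm.toLinearMap, ?_, ?_, ?_⟩
  · rw [← LinearMap.toMatrix'_comp]; simp
  · rw [← LinearMap.toMatrix'_comp]; simp
  · intro M
    have he : e' (Matrix.toLin' M) = Matrix.toLin' (e M) := by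
      change Matrix.toLin' (e (LinearMap.toMatrix' (Matrix.toLin' M))) = _
      rw [LinearMap.toMatrix'_toLin']
    apply Matrix.toLin'.injective
    rw [Matrix.toLin'_mul, Matrix.toLin'_mul, ← he, hT, Matrix.toLin'_toMatrix']
    ext1 x
    ext1
    simp [LinearEquiv.conjAlgEquiv_apply]

/-- Skolem–Noether: two embeddings of a form in matrix algebras are conjugate. -/
theorem IsForm.exists_conj {f : S →ₐ[F] Matrix ι ι L} (hf : IsForm L f)
    {g : S →ₐ[F] Matrix κ κ L} (hg : IsForm L g) :
    ∃ (P : Matrix ι κ L) (Q : Matrix κ ι L), P * Q = 1 ∧ Q * P = 1 ∧ ∀ s, f s * P = P * g s := by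
  obtain ⟨P, Q, hPQ, hQP, h⟩ := exists_conj_of_algEquiv (hg.algEquiv.symm.trans hf.algEquiv)
  refine ⟨P, Q, hPQ, hQP, fun s => ?_⟩
  have hs : hg.algEquiv (1 ⊗ₜ s) = g s := by rw [hg.algEquiv_tmul, one_smul]
  rw [← h, AlgEquiv.trans_apply, ← hs, AlgEquiv.symm_apply_apply, hf.algEquiv_tmul, one_smul]

theorem IsForm.exists_eq_smul_one {f : S →ₐ[F] Matrix ι ι L} (hf : IsForm L f) {M : Matrix ι ι L}
    (hM : ∀ s, f s * M = M * f s) : ∃ a : L, M = a • 1 := by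
  obtain ⟨a, ha⟩ := (Algebra.IsCentral.mem_center_iff L).1 (hf.mem_center hM)
  exact ⟨a, by rw [ha, Algebra.algebraMap_eq_smul_one]⟩

theorem IsForm.mapMatrix {R : Type*} [Ring R] [Algebra F R] [Algebra L R] [IsScalarTower F L R]
    [Module.Finite F S] {f : S →ₐ[F] R} (hf : IsForm L f) : IsForm L (f.mapMatrix (m := κ)) := by
  refine isForm_of_span _ (eq_top_iff.2 fun M _ => ?_) (by
    rw [Module.finrank_matrix, Module.finrank_matrix, hf.finrank_eq])
  rw [Matrix.matrix_eq_sum_single M]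
  refine sum_mem fun i _ => sum_mem fun j _ => ?_
  refine hf.map_mem (W := Submodule.span L _) (Matrix.singleLinearMap L i j) (fun s => ?_) (M i j)
  exact Submodule.subset_span ⟨Matrix.single i j s, by simp [Matrix.map_single]⟩

/-- The embedding of the opposite algebra obtained by transposition. -/
def transposeHom (f : S →ₐ[F] Matrix ι ι L) : Sᵐᵒᵖ →ₐ[F] Matrix ι ι L :=
  ((Matrix.transposeAlgEquiv ι F L).symm : _ →ₐ[F] _).comp (AlgHom.op f)

theorem IsForm.transposeHom [Module.Finite F S] {f : S →ₐ[F] Matrix ι ι L} (hf : IsForm L f) :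
    IsForm L (transposeHom f) := by
  refine isForm_matrix_of_span _ (eq_top_iff.2 fun M _ => ?_) (by
    rw [← hf.finrank_matrix]
    exact (MulOpposite.opLinearEquiv F (M := S)).symm.finrank_eq)
  rw [← Matrix.transpose_transpose M]
  refine hf.map_mem (W := Submodule.span L _) (Matrix.transposeLinearEquiv ι ι L L).toLinearMap
    (fun s => ?_) Mᵀ
  exact Submodule.subset_span ⟨MulOpposite.op s, rfl⟩

/-- The tensor product of two representations, by Kronecker products. -/
def kroneckerHom (f : S →ₐ[F] Matrix ι ι L) (g : S' →ₐ[F] Matrix κ κ L) :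
    S ⊗[F] S' →ₐ[F] Matrix (ι × κ) (ι × κ) L :=
  ((Algebra.TensorProduct.lmul' F (S := L)).mapMatrix).comp
    ((Matrix.kroneckerTMulAlgEquiv ι κ F F L L : _ →ₐ[F] _).comp (Algebra.TensorProduct.map f g))

theorem kroneckerHom_tmul (f : S →ₐ[F] Matrix ι ι L)
    (g : S' →ₐ[F] Matrix κ κ L) (s : S) (s' : S') :
    kroneckerHom f g (s ⊗ₜ s') = f s ⊗ₖ g s' := by
  ext i j
  simp [kroneckerHom]

theorem IsForm.kroneckerHom [Module.Finite F S] [Module.Finite F S'] {f : S →ₐ[F] Matrix ι ι L}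
    (hf : IsForm L f) {g : S' →ₐ[F] Matrix κ κ L} (hg : IsForm L g) :
    IsForm L (kroneckerHom f g) := by
  refine isForm_matrix_of_span _ (eq_top_iff.2 fun M _ => ?_) (by
    rw [Module.finrank_tensorProduct, hf.finrank_matrix, hg.finrank_matrix, Fintype.card_prod,
      mul_pow])
  have hmem (A : Matrix ι ι L) (B : Matrix κ κ L) :
      A ⊗ₖ B ∈ Submodule.span L (Set.range (TorusBrauer.kroneckerHom f g)) := by
    let β : Matrix ι ι L →ₗ[L] Matrix κ κ L →ₗ[L] Matrix (ι × κ) (ι × κ) L := kroneckerBilinear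
    refine hf.map_mem (W := Submodule.span L _) (β.flip B) (fun s => ?_) A
    refine hg.map_mem (W := Submodule.span L _) (β (f s)) (fun s' => ?_) B
    exact Submodule.subset_span ⟨s ⊗ₜ s', kroneckerHom_tmul f g s s'⟩
  rw [Matrix.matrix_eq_sum_single M]
  refine sum_mem fun i _ => sum_mem fun j _ => ?_
  rw [← mul_one (M i j), ← Matrix.single_kronecker_single]
  exact hmem _ _

/-- The Kronecker product of a family of matrices. -/
def piKronecker (F : Type*) [Field F] [Algebra F L] (ι : Type*) (m : ℕ) :
    MultilinearMap F (fun _ : Fin m => Matrix ι ι L) (Matrix (Fin m → ι) (Fin m → ι) L) :=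
  MultilinearMap.pi fun x => MultilinearMap.pi fun y =>
    (MultilinearMap.mkPiAlgebra F (Fin m) L).compLinearMap fun i =>
      Matrix.entryLinearMap F L (x i) (y i)

omit [Fintype ι] [DecidableEq ι] in
theorem piKronecker_apply (m : ℕ) (M : Fin m → Matrix ι ι L) (x y : Fin m → ι) :
    piKronecker F ι m M x y = ∏ i, M i (x i) (y i) := rfl

omit [Fintype ι] [DecidableEq ι] in
theorem piKronecker_smul_const (m : ℕ) (a : L) (M : Matrix ι ι L) :
    (piKronecker F ι m fun _ => a • M) = a ^ m • piKronecker F ι m fun _ => M := by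
  ext x y
  simp [piKronecker_apply, Finset.prod_mul_distrib]

omit [Fintype ι] [DecidableEq ι] in
theorem map_piKronecker (m : ℕ) (σ : Gal(L/F)) (M : Fin m → Matrix ι ι L) :
    (piKronecker F ι m M).map σ = piKronecker F ι m fun i => (M i).map σ := by
  ext x y
  simp [piKronecker_apply]

omit [Fintype ι] in
theorem piKronecker_single_one {m : ℕ} (x y : Fin m → ι) :
    piKronecker F ι m (fun i => Matrix.single (x i) (y i) (1 : L)) = Matrix.single x y 1 := by
  ext x' y'
  simp only [piKronecker_apply, Matrix.single_apply, Finset.prod_ite_zero, Finset.prod_const_one,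
    Finset.mem_univ, true_imp_iff, forall_and, funext_iff]

omit [Fintype ι] in
theorem piKronecker_one (m : ℕ) : piKronecker F ι m (1 : Fin m → Matrix ι ι L) = 1 := by
  ext x y
  simp only [piKronecker_apply, Pi.one_apply, Matrix.one_apply, Finset.prod_ite_zero,
    Finset.prod_const_one, Finset.mem_univ, true_imp_iff, funext_iff]

omit [DecidableEq ι] in
theorem piKronecker_mul (m : ℕ) (M N : Fin m → Matrix ι ι L) :
    piKronecker F ι m (M * N) = piKronecker F ι m M * piKronecker F ι m N := by
  ext x y
  simp only [piKronecker_apply, Matrix.mul_apply, Pi.mul_apply, ← Finset.prod_mul_distrib]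
  rw [Finset.prod_univ_sum, Fintype.piFinset_univ]

/-- The tensor power of a representation. -/
def piKroneckerHom (m : ℕ) (f : S →ₐ[F] Matrix ι ι L) :
    (⨂[F] _ : Fin m, S) →ₐ[F] Matrix (Fin m → ι) (Fin m → ι) L :=
  PiTensorProduct.liftAlgHom ((piKronecker F ι m).compLinearMap fun _ => f.toLinearMap)
    (by
      rw [← piKronecker_one (F := F) m]
      exact congrArg (piKronecker F ι m) (funext fun _ => map_one f))
    (fun s s' => by
      refine .trans ?_ (piKronecker_mul m (fun i => f (s i)) (fun i => f (s' i)))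
      exact congrArg (piKronecker F ι m) (funext fun i => map_mul f _ _))

theorem piKroneckerHom_tprod (m : ℕ) (f : S →ₐ[F] Matrix ι ι L) (s : Fin m → S) :
    piKroneckerHom m f (PiTensorProduct.tprod F s) = piKronecker F ι m fun i => f (s i) := by
  rw [piKroneckerHom, PiTensorProduct.liftAlgHom_apply, PiTensorProduct.lift.tprod]; rfl

theorem IsForm.piKronecker_mem_span_range [Module.Finite F S] {f : S →ₐ[F] Matrix ι ι L}
    (hf : IsForm L f) {m : ℕ} (M : Fin m → Matrix ι ι L) :
    piKronecker L ι m M ∈ Submodule.span L (Set.range (piKroneckerHom m f)) := by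
  let b := Module.finBasis F S
  have hM : M = fun i => ∑ j, (hf.basis b).repr (M i) j • f (b j) := by
    ext1 i
    conv_lhs => rw [← (hf.basis b).sum_repr (M i)]
    simp only [hf.basis_apply]
  rw [hM, MultilinearMap.map_sum]
  refine sum_mem fun r _ => ?_
  rw [MultilinearMap.map_smul_univ]
  refine Submodule.smul_mem _ _ (Submodule.subset_span
    ⟨PiTensorProduct.tprod F fun i => b (r i), ?_⟩)
  rw [piKroneckerHom_tprod]
  rfl

theorem IsForm.piKroneckerHom [Module.Finite F S] {f : S →ₐ[F] Matrix ι ι L} (hf : IsForm L f)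
    (m : ℕ) : IsForm L (piKroneckerHom m f) := by
  refine isForm_matrix_of_span _ (eq_top_iff.2 fun M _ => ?_) ?_
  · rw [Matrix.matrix_eq_sum_single M]
    refine sum_mem fun x _ => sum_mem fun y _ => ?_
    rw [← mul_one (M x y), ← smul_eq_mul, ← Matrix.smul_single,
      ← piKronecker_single_one (F := L)]
    exact Submodule.smul_mem _ _ (hf.piKronecker_mem_span_range _)
  · rw [Module.finrank_eq_card_basis (Basis.piTensorProduct fun _ : Fin m => Module.finBasis F S)]
    simp only [Fintype.card_pi, Finset.prod_const, Fintype.card_fin, Finset.card_univ]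
    rw [hf.finrank_matrix, ← pow_mul, ← pow_mul, mul_comm]

end MatrixForms

/-! ### Hilbert's theorem 90 over a twisted finite set -/

section Hilbert

open Topology Matrix

variable {F L : Type*} [Field F] [Field L] [Algebra F L] {ι : Type*} [Fintype ι]

theorem map_galois_mul {κ μ : Type*} (σ : Gal(L/F)) (A : Matrix κ ι L) (B : Matrix ι μ L) :
    (A * B).map σ = A.map σ * B.map σ := Matrix.map_mul (f := (σ : L →+* L))

theorem map_galois_smul {κ μ : Type*} (σ : Gal(L/F)) (a : L) (A : Matrix κ μ L) :
    (a • A).map σ = σ a • A.map σ := Matrix.ext fun _ _ => map_mul σ _ _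

theorem map_galois_one {κ : Type*} [DecidableEq κ] (σ : Gal(L/F)) :
    (1 : Matrix κ κ L).map σ = 1 :=
  Matrix.map_one _ (map_zero _) (map_one _)

theorem eventually_comp_eq [Algebra.IsIntegral F L] {Y : Type*} [Finite Y] (v : Y → L) :
    ∀ᶠ σ : Gal(L/F) in 𝓝 1, ∀ y, σ (v y) = v y :=
  Filter.eventually_all.2 fun y => eventually_apply_eq (v y)

theorem eventually_map_eq [Algebra.IsIntegral F L] {κ μ : Type*} [Finite κ] [Finite μ]
    (A : Matrix κ μ L) : ∀ᶠ σ : Gal(L/F) in 𝓝 1, A.map σ = A := by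
  filter_upwards [eventually_comp_eq fun x : κ × μ => A x.1 x.2] with σ h
  ext i j
  exact h (i, j)

variable {Y G : Type*} [Finite Y] [Group G] [MulAction G Y] (γ : Gal(L/F) →* G)

/-- The semilinear action `(σ v)(y) = w_σ(y) σ(v(γ_σ⁻¹ y))` on `Map(Y, L^ι)` attached to a cocycle
`w` with values in `Map(Y, GL_ι(L))`, where the Galois group permutes `Y` through `γ`. -/
def twistedAction [Algebra.IsIntegral F L] [DecidableEq ι] (hγ : ∀ᶠ σ in 𝓝 1, γ σ = 1)
    (w : Gal(L/F) → Y → Matrix ι ι L)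
    (hmul : ∀ σ τ y, w (σ * τ) y = w σ y * (w τ ((γ σ)⁻¹ • y)).map σ)
    (hw : ∀ᶠ σ in 𝓝 1, w σ = 1) : SemilinearAction F L (Y → ι → L) where
  toFun σ :=
    { toFun := fun v y => w σ y *ᵥ (σ ∘ v ((γ σ)⁻¹ • y))
      map_zero' := by
        ext y i
        simp [Matrix.mulVec, dotProduct]
      map_add' := fun v v' => by
        ext y i
        simp [Matrix.mulVec, dotProduct, mul_add, Finset.sum_add_distrib] }
  map_smul' σ a v := by
    ext y i
    simp [Matrix.mulVec, dotProduct, Finset.mul_sum, mul_left_comm]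
  map_mul' σ τ v := by
    funext y
    change w (σ * τ) y *ᵥ _ = w σ y *ᵥ (σ ∘ (w τ ((γ σ)⁻¹ • y) *ᵥ _))
    have h := RingHom.map_mulVec (σ : L →+* L) (w τ ((γ σ)⁻¹ • y))
      (τ ∘ v ((γ τ)⁻¹ • (γ σ)⁻¹ • y))
    rw [hmul, ← Matrix.mulVec_mulVec, map_mul, _root_.mul_inv_rev, mul_smul]
    exact congrArg (w σ y *ᵥ ·) (funext h).symm
  eventually_fixed v := by
    filter_upwards [hγ, hw, Filter.eventually_all.2 fun y => eventually_comp_eq (v y)]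
      with σ h h' h''
    funext y
    change w σ y *ᵥ (σ ∘ v ((γ σ)⁻¹ • y)) = v y
    rw [h, h', inv_one, one_smul, Pi.one_apply, Matrix.one_mulVec]
    exact funext (h'' y)

omit [Finite Y] in
theorem exists_orbit_representative :
    ∃ rep : Y → Y, (∀ σ y, rep (γ σ • y) = rep y) ∧ ∀ y, ∃ σ, γ σ • rep y = y := by
  let s := MulAction.orbitRel γ.range Y
  refine ⟨fun y => (Quotient.mk s y).out, fun σ y => ?_, fun y => ?_⟩
  · exact congrArg Quotient.out (Quotient.sound ⟨⟨γ σ, σ, rfl⟩, rfl⟩)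
  · obtain ⟨⟨_, σ, rfl⟩, hσ⟩ := s.symm (Quotient.mk_out y)
    exact ⟨σ, hσ⟩

theorem exists_isUnit_of_span_eq_top [DecidableEq ι] {V : Set (ι → L)}
    (hV : Submodule.span L V = ⊤) : ∃ v : ι → ι → L, (∀ j, v j ∈ V) ∧ IsUnit (of v)ᵀ := by
  let b := Module.Basis.ofSpan hV.ge
  let e := (Pi.basisFun L ι).indexEquiv b
  refine ⟨fun j => b (e j), fun j => Module.Basis.ofSpan_subset hV.ge ⟨e j, rfl⟩, ?_⟩
  exact Matrix.linearIndependent_cols_iff_isUnit.1 (b.linearIndependent.comp e e.injective)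

variable [IsGalois F L]

theorem exists_invariant_matrix [DecidableEq ι] (hγ : ∀ᶠ σ in 𝓝 1, γ σ = 1)
    (w : Gal(L/F) → Y → Matrix ι ι L)
    (hmul : ∀ σ τ y, w (σ * τ) y = w σ y * (w τ ((γ σ)⁻¹ • y)).map σ)
    (hw : ∀ᶠ σ in 𝓝 1, w σ = 1) :
    ∃ N : Y → GL ι L, ∀ σ y, w σ y * (N ((γ σ)⁻¹ • y)).1.map σ = (N y).1 := by
  classical
  let ρ := twistedAction γ hγ w hmul hw
  have hspan (y : Y) : Submodule.span L (LinearMap.proj (R := L) (φ := fun _ : Y => ι → L) y ''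
      (ρ.invariants : Set (Y → ι → L))) = ⊤ := by
    rw [← Submodule.map_span, ρ.span_invariants, Submodule.map_top, LinearMap.range_eq_top]
    exact Function.surjective_eval y
  choose v hv hunit using fun y => exists_isUnit_of_span_eq_top (hspan y)
  choose V hV hVv using hv
  obtain ⟨rep, hrep, hrep'⟩ := exists_orbit_representative (Y := Y) γ
  have hfix (z : Y) (σ : Gal(L/F)) (y : Y) :
      w σ y * (of fun j => V z j ((γ σ)⁻¹ • y))ᵀ.map σ = (of fun j => V z j y)ᵀ := by
    ext i j
    exact congrFun (congrFun (hV z j σ) y) i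
  have hone (σ : Gal(L/F)) (y : Y) : w σ y * (w σ⁻¹ ((γ σ)⁻¹ • y)).map σ = 1 := by
    rw [← hmul, mul_inv_cancel, hw.self_of_nhds, Pi.one_apply]
  have hN (y : Y) : IsUnit (of fun j => V (rep y) j y)ᵀ := by
    obtain ⟨σ, hσ⟩ := hrep' y
    rw [← hfix _ σ, inv_smul_eq_iff.2 hσ.symm]
    refine (IsUnit.of_mul_eq_one _ (hone σ y)).mul ?_
    have h : (of fun j => V (rep y) j (rep y))ᵀ = (of (v (rep y)))ᵀ := by
      rw [← funext (hVv (rep y))]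
      rfl
    rw [h]
    exact (hunit (rep y)).map ((σ : L →+* L).mapMatrix)
  refine ⟨fun y => (hN y).unit, fun σ y => ?_⟩
  have h : rep ((γ σ)⁻¹ • y) = rep y := by rw [← map_inv, hrep]
  simp only [IsUnit.unit_spec, h, hfix]

theorem exists_invariant_unit (hγ : ∀ᶠ σ in 𝓝 1, γ σ = 1) (w : Gal(L/F) → Y → Lˣ)
    (hmul : ∀ σ τ y, w (σ * τ) y = w σ y * σ • w τ ((γ σ)⁻¹ • y))
    (hw : ∀ᶠ σ in 𝓝 1, w σ = 1) :
    ∃ D : Y → Lˣ, ∀ σ y, w σ y * σ • D ((γ σ)⁻¹ • y) = D y := by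
  obtain ⟨N, hN⟩ := exists_invariant_matrix γ hγ
    (fun σ y => (w σ y : L) • (1 : Matrix Unit Unit L))
    (fun σ τ y => by
      rw [hmul, map_galois_smul, map_galois_one, smul_mul_smul_comm, mul_one]
      rfl)
    (by
      filter_upwards [hw] with σ h
      simp only [h, Pi.one_apply, Units.val_one, one_smul]
      rfl)
  refine ⟨fun y => GeneralLinearGroup.det (N y), fun σ y => Units.ext ?_⟩
  simpa using congrFun (congrFun (hN σ y) ()) ()

theorem exists_eq_smul_div (b : Gal(L/F) → Lˣ) (hmul : ∀ σ τ, b (σ * τ) = b σ * σ • b τ)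
    (hb : ∀ᶠ σ in 𝓝 1, b σ = 1) : ∃ d : Lˣ, ∀ σ, b σ * σ • d = d := by
  obtain ⟨D, hD⟩ := exists_invariant_unit (Y := Unit) (1 : Gal(L/F) →* Unit)
    (Filter.Eventually.of_forall fun _ => rfl) (fun σ _ => b σ) (fun σ τ _ => hmul σ τ)
    (hb.mono fun σ h => funext fun _ => h)
  exact ⟨D (), fun σ => hD σ ()⟩

end Hilbert

/-! ### Algebras split by a twisted form of `F^Y` -/

section TwistFun

open Topology Matrix

variable {F L : Type*} [Field F] [Field L] [Algebra F L] {Y G : Type*} [Group G] [MulAction G Y]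
  (γ : Gal(L/F) →* G)

variable (Y) in
/-- The form of `F^Y` obtained by letting the Galois group permute `Y` through `γ`. -/
def twistFun : Subalgebra F (Y → L) where
  carrier := {φ | ∀ (σ : Gal(L/F)) (y : Y), φ (γ σ • y) = σ (φ y)}
  mul_mem' hf hf' σ y := by simp [hf σ y, hf' σ y]
  add_mem' hf hf' σ y := by simp [hf σ y, hf' σ y]
  algebraMap_mem' r σ y := by simp

/-- The semilinear action on `L^Y` that permutes `Y` through `γ`. -/
def permAction [Algebra.IsIntegral F L] [Finite Y] (hγ : ∀ᶠ σ in 𝓝 1, γ σ = 1) :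
    SemilinearAction F L (Y → L) where
  toFun σ :=
    { toFun := fun v y => σ (v ((γ σ)⁻¹ • y))
      map_zero' := funext fun _ => map_zero σ
      map_add' := fun _ _ => funext fun _ => map_add σ _ _ }
  map_smul' σ a v := funext fun _ => map_mul σ _ _
  map_mul' σ τ v := by
    funext y
    change (σ * τ) (v ((γ (σ * τ))⁻¹ • y)) = σ (τ (v ((γ τ)⁻¹ • (γ σ)⁻¹ • y)))
    rw [map_mul, _root_.mul_inv_rev, mul_smul]
    rfl
  eventually_fixed v := by
    filter_upwards [hγ, eventually_comp_eq v] with σ h h'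
    funext y
    change σ (v ((γ σ)⁻¹ • y)) = v y
    rw [h, inv_one, one_smul, h']

variable [IsGalois F L]

theorem isForm_val_of_invariants {R : Type*} [Ring R] [Algebra F R] [Algebra L R]
    [IsScalarTower F L R] [Module.Finite L R] (ρ : SemilinearAction F L R) (S : Subalgebra F R)
    (h : ∀ r, r ∈ S ↔ ∀ σ, ρ σ r = r) : Module.Finite F S ∧ IsForm L S.val := by
  have hS : Subalgebra.toSubmodule S = ρ.invariants := Submodule.ext h
  have hfin : Module.Finite F (Subalgebra.toSubmodule S) := hS ▸ ρ.finite_invariants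
  have : Module.Finite F S := hfin
  refine ⟨hfin, isForm_of_span _ ?_ ?_⟩
  · rw [← ρ.span_invariants, ← hS]
    exact congrArg (Submodule.span L) Subtype.range_coe
  · change Module.finrank F (Subalgebra.toSubmodule S) = _
    rw [hS, ρ.finrank_invariants]

theorem isForm_val_twistFun [Finite Y] (hγ : ∀ᶠ σ in 𝓝 1, γ σ = 1) :
    Module.Finite F (twistFun Y γ) ∧ IsForm L (twistFun Y γ).val := by
  refine isForm_val_of_invariants (permAction γ hγ) _ fun v =>
    ⟨fun hv σ => funext fun y => ?_, fun hv σ y => ?_⟩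
  · change σ (v ((γ σ)⁻¹ • y)) = v y
    rw [← hv, smul_inv_smul]
  · conv_lhs => rw [← hv σ]
    change σ (v ((γ σ)⁻¹ • γ σ • y)) = σ (v y)
    rw [inv_smul_smul]

theorem finrank_twistFun [Fintype Y] (hγ : ∀ᶠ σ in 𝓝 1, γ σ = 1) :
    Module.finrank F (twistFun Y γ) = Fintype.card Y := by
  rw [(isForm_val_twistFun γ hγ).2.finrank_eq, Module.finrank_fintype_fun_eq_card]

theorem bijective_algebraMap_twistFun_unit (γ : Gal(L/F) →* Unit) :
    Function.Bijective (algebraMap F (twistFun Unit γ)) := by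
  refine ⟨(algebraMap F _).injective, fun φ => ?_⟩
  obtain ⟨a, ha⟩ := (InfiniteGalois.mem_range_algebraMap_iff_fixed (φ.1 ())).2
    fun σ => (φ.2 σ ()).symm
  exact ⟨a, Subtype.ext (funext fun _ => ha)⟩

end TwistFun

section Families

open Topology Matrix

variable {F L : Type*} [Field F] [Field L] [Algebra F L] {Y G : Type*} [Group G] [MulAction G Y]
  {γ : Gal(L/F) →* G} {S ι : Type*} [Ring S] [Algebra F S] [Fintype ι] [DecidableEq ι]
  {θ : Y → S →ₐ[F] Matrix ι ι L}

/-- A family of forms `S → M_ι(L)` which is equivariant when the Galois group permutes `Y` through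
`γ`, that is a form `S → M_ι(K)` over the twisted form `K` of `F^Y`. -/
structure IsEquivariantFamily (γ : Gal(L/F) →* G) (θ : Y → S →ₐ[F] Matrix ι ι L) : Prop where
  isForm : ∀ y, IsForm L (θ y)
  apply_smul : ∀ σ y s, θ (γ σ • y) s = (θ y s).map σ

/-- The homomorphism to the matrices over the twisted form of `F^Y` given by an equivariant
family. -/
def IsEquivariantFamily.toTwistFun (hθ : IsEquivariantFamily γ θ) :
    S →ₐ[F] Matrix ι ι (twistFun Y γ) where
  toFun s := of fun i j => ⟨fun y => θ y s i j, fun σ y =>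
    congrFun (congrFun (hθ.apply_smul σ y s) i) j⟩
  map_one' := by
    ext i j y
    rcases eq_or_ne i j with rfl | h <;> simp [*]
  map_mul' s s' := by
    ext i j y
    simp [Matrix.mul_apply]
  map_zero' := by
    ext i j y
    simp
  map_add' s s' := by
    ext i j y
    simp
  commutes' r := by
    ext i j y
    rcases eq_or_ne i j with rfl | h <;> simp [Matrix.algebraMap_matrix_apply, *]

theorem injective_extendScalars_of_isForm {K : Type*} [CommRing K] [Algebra F K]
    {ev : Y → K →ₐ[F] L} (hev : ∀ a, (∀ y, ev y a = 0) → a = 0) (h : S →ₐ[F] Matrix ι ι K)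
    (hθ : ∀ y, IsForm L ((ev y).mapMatrix.comp h)) : Function.Injective (extendScalars K h) := by
  refine (injective_iff_map_eq_zero _).2 fun z hz => ?_
  let b := Module.Basis.ofVectorSpace F S
  have hsum : ∑ i ∈ ((b.baseChange K).repr z).support, (b.baseChange K).repr z i • h (b i) = 0 := by
    rw [← hz]
    conv_rhs => rw [← (b.baseChange K).linearCombination_repr z]
    rw [Finsupp.linearCombination_apply, Finsupp.sum, map_sum]
    refine Finset.sum_congr rfl fun i _ => ?_
    rw [map_smul, Module.Basis.baseChange_apply, extendScalars_tmul, one_smul]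
  refine (b.baseChange K).repr.map_eq_zero_iff.1 (Finsupp.support_eq_empty.1 ?_)
  refine Finset.eq_empty_of_forall_notMem fun i hi =>
    Finsupp.mem_support_iff.1 hi (hev _ fun y => ?_)
  refine linearIndependent_iff'.1 ((hθ y).basis b).linearIndependent _
    (fun i => ev y ((b.baseChange K).repr z i)) ?_ i hi
  rw [← map_zero (ev y).mapMatrix, ← hsum, map_sum]
  refine Finset.sum_congr rfl fun i _ => ?_
  ext k l
  simp [IsForm.basis_apply]

theorem isSplit_of_injective {K : Type*} [CommRing K] [Algebra F K] [Module.Finite F K]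
    [Module.Finite F S] [Nonempty ι] (k : K ⊗[F] S →ₐ[K] Matrix ι ι K)
    (hk : Function.Injective k) (hd : Module.finrank F S = Fintype.card ι ^ 2) :
    IsSplit K (K ⊗[F] S) := by
  have hb : Function.Bijective k := by
    refine ⟨hk, (LinearMap.injective_iff_surjective_of_finrank_eq_finrank
      (f := (k.restrictScalars F).toLinearMap) ?_).1 hk⟩
    rw [Module.finrank_tensorProduct, Module.finrank_matrix, hd, sq, mul_comm]
  exact ⟨Fintype.card ι, Fintype.card_ne_zero, ⟨(AlgEquiv.ofBijective k hb).trans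
    (Matrix.reindexAlgEquiv K K (Fintype.equivFin ι))⟩⟩

theorem IsEquivariantFamily.isSplit [IsGalois F L] [Finite Y] [Nonempty Y] [Nonempty ι]
    [Module.Finite F S] (hθ : IsEquivariantFamily γ θ) (hγ : ∀ᶠ σ in 𝓝 1, γ σ = 1)
    {K : Type*} [CommRing K] [Algebra F K] (j : K ≃ₐ[F] twistFun Y γ) :
    IsSplit K (K ⊗[F] S) := by
  have := (isForm_val_twistFun (Y := Y) γ hγ).1
  have : Module.Finite F K := Module.Finite.equiv j.symm.toLinearEquiv
  let ev (y : Y) : K →ₐ[F] L :=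
    (Pi.evalAlgHom F (fun _ : Y => L) y).comp ((twistFun Y γ).val.comp j)
  have hcomp (y : Y) : (ev y).mapMatrix.comp
      ((j.symm : twistFun Y γ →ₐ[F] K).mapMatrix.comp hθ.toTwistFun) = θ y := by
    ext s i k
    simp [ev, toTwistFun]
  refine isSplit_of_injective _ (injective_extendScalars_of_isForm (ev := ev) (fun a ha => ?_) _
    fun y => (hcomp y).symm ▸ hθ.isForm y) (hθ.isForm (Classical.arbitrary Y)).finrank_matrix
  exact j.map_eq_zero_iff.1 (Subtype.ext (funext ha))

theorem isSplit_of_isSplit_tensor_self {K : Type*} [Field K] [Algebra K S]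
    (h : IsSplit K (K ⊗[K] S)) : IsSplit K S :=
  let ⟨d, hd, ⟨e⟩⟩ := h
  ⟨d, hd, ⟨(Algebra.TensorProduct.lid K S).symm.trans e⟩⟩

theorem IsEquivariantFamily.isSplit_of_unit [IsGalois F L] [Nonempty ι] [Module.Finite F S]
    {γ : Gal(L/F) →* Unit} {θ : Unit → S →ₐ[F] Matrix ι ι L} (hθ : IsEquivariantFamily γ θ) :
    IsSplit F S :=
  isSplit_of_isSplit_tensor_self <| hθ.isSplit (Filter.Eventually.of_forall fun _ => rfl)
    (AlgEquiv.ofBijective (Algebra.ofId F _) (bijective_algebraMap_twistFun_unit γ))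

theorem span_range_of_matrix_equiv {K : Type*} [CommRing K] [Algebra F K] (ev : K →ₐ[F] L)
    (e : K ⊗[F] S ≃ₐ[K] Matrix ι ι K) :
    Submodule.span L (Set.range fun s : S => (e (1 ⊗ₜ s)).map ev) = ⊤ := by
  have hmem (z : K ⊗[F] S) :
      (e z).map ev ∈ Submodule.span L (Set.range fun s : S => (e (1 ⊗ₜ s)).map ev) := by
    induction z with
    | zero => rw [map_zero, Matrix.map_zero _ (map_zero _)]; exact zero_mem _
    | add z w hz hw =>
      rw [map_add, Matrix.map_add _ (map_add _)]
      exact add_mem hz hw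
    | tmul k s =>
      rw [← mul_one k, ← smul_eq_mul, ← TensorProduct.smul_tmul', map_smul]
      have h : (k • e (1 ⊗ₜ s)).map ev = ev k • (e (1 ⊗ₜ s)).map ev :=
        Matrix.ext fun _ _ => map_mul ev _ _
      rw [h]
      exact Submodule.smul_mem _ _ (Submodule.subset_span ⟨s, rfl⟩)
  refine eq_top_iff.2 fun M _ => ?_
  rw [Matrix.matrix_eq_sum_single M]
  refine sum_mem fun i _ => sum_mem fun j _ => ?_
  have h := Submodule.smul_mem _ (M i j) (hmem (e.symm (Matrix.single i j 1)))
  rwa [e.apply_symm_apply, Matrix.map_single _ _ _ ev, map_one, Matrix.smul_single,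
    smul_eq_mul, mul_one] at h

theorem exists_isEquivariantFamily [IsGalois F L] [Finite Y] [Nonempty Y] [Module.Finite F S]
    (hγ : ∀ᶠ σ in 𝓝 1, γ σ = 1) (hS : IsSplit (twistFun Y γ) (twistFun Y γ ⊗[F] S)) :
    ∃ (d : ℕ) (_ : d ≠ 0) (θ : Y → S →ₐ[F] Matrix (Fin d) (Fin d) L),
      IsEquivariantFamily γ θ := by
  obtain ⟨d, hd, ⟨e⟩⟩ := hS
  have := (isForm_val_twistFun (Y := Y) γ hγ).1
  let ev (y : Y) : twistFun Y γ →ₐ[F] L :=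
    (Pi.evalAlgHom F (fun _ : Y => L) y).comp (twistFun Y γ).val
  let e' : S →ₐ[F] Matrix (Fin d) (Fin d) (twistFun Y γ) :=
    (e.restrictScalars F).toAlgHom.comp Algebra.TensorProduct.includeRight
  have hfin : Module.finrank F S = Fintype.card (Fin d) ^ 2 := by
    have := Fintype.ofFinite Y
    have h := (e.restrictScalars F).toLinearEquiv.finrank_eq
    rw [Module.finrank_tensorProduct, Module.finrank_matrix, finrank_twistFun γ hγ, mul_comm] at h
    rw [Nat.eq_of_mul_eq_mul_right Fintype.card_pos h, sq]
  exact ⟨d, hd, fun y => (ev y).mapMatrix.comp e',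
    fun y => isForm_matrix_of_span _ (span_range_of_matrix_equiv (ev y) e) hfin,
    fun σ y s => Matrix.ext fun i j => (e' s i j).2 σ y⟩

end Families

/-! ### Factor sets -/

section GaloisLift

open Topology Matrix
open scoped Kronecker

variable {F L : Type*} [Field F] [Field L] [Algebra F L] {S S' ι κ : Type*} [Ring S] [Algebra F S]
  [Ring S'] [Algebra F S'] [Fintype ι] [DecidableEq ι] [Fintype κ] [DecidableEq κ]

theorem IsForm.exists_eq_smul {f : S →ₐ[F] Matrix ι ι L} (hf : IsForm L f)
    {g : S →ₐ[F] Matrix κ κ L} {P R : Matrix ι κ L} {Q : Matrix κ ι L} (hPQ : P * Q = 1)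
    (hQP : Q * P = 1) (hP : ∀ s, f s * P = P * g s) (hR : ∀ s, f s * R = R * g s) (hR0 : R ≠ 0) :
    ∃ a : Lˣ, R = (a : L) • P := by
  have hQ (s : S) : g s * Q = Q * f s := by
    rw [← mul_one (f s), ← hPQ, ← Matrix.mul_assoc (f s), hP, Matrix.mul_assoc, ← Matrix.mul_assoc,
      hQP, Matrix.one_mul]
  obtain ⟨a, ha⟩ := hf.exists_eq_smul_one (M := R * Q) fun s => by
    rw [← Matrix.mul_assoc, hR, Matrix.mul_assoc, hQ, Matrix.mul_assoc]
  have hRP : R = a • P := by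
    rw [← Matrix.one_mul P, ← Matrix.smul_mul, ← ha, Matrix.mul_assoc, hQP, Matrix.mul_one]
  exact ⟨.mk0 a fun h => hR0 (by rw [hRP, h, zero_smul]), hRP⟩

/-- A lift to `GL_ι(L)` of the cocycle in `PGL_ι(L)` that classifies the form `f` of `M_ι(L)`: the
Galois action `M ↦ p_σ σ(M) p_σ⁻¹` fixes the image of `f`. Such a lift is a cocycle up to a factor
set with values in `Lˣ`. -/
structure GaloisLift (f : S →ₐ[F] Matrix ι ι L) where
  toFun : Gal(L/F) → GL ι L
  factor : Gal(L/F) → Gal(L/F) → Lˣ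
  mul_map' : ∀ σ τ, (toFun σ : Matrix ι ι L) * (toFun τ : Matrix ι ι L).map σ =
    (factor σ τ : L) • (toFun (σ * τ) : Matrix ι ι L)
  eventually_eq_one : ∀ᶠ σ in 𝓝 1, toFun σ = 1
  mul_map_apply' : ∀ σ s,
    (toFun σ : Matrix ι ι L) * (f s).map σ = f s * (toFun σ : Matrix ι ι L)

namespace GaloisLift

instance (f : S →ₐ[F] Matrix ι ι L) : CoeFun (GaloisLift f) (fun _ => Gal(L/F) → GL ι L) := ⟨toFun⟩

variable {f : S →ₐ[F] Matrix ι ι L} {g : S' →ₐ[F] Matrix κ κ L} (p : GaloisLift f)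
  (q : GaloisLift g)

theorem mul_map (σ τ : Gal(L/F)) :
    (p σ).1 * (p τ).1.map σ = (p.factor σ τ : L) • (p (σ * τ)).1 := p.mul_map' σ τ

theorem mul_map_apply (σ : Gal(L/F)) (s : S) : (p σ).1 * (f s).map σ = f s * (p σ).1 :=
  p.mul_map_apply' σ s

theorem map_apply_mul_inv (σ : Gal(L/F)) (s : S) :
    (f s).map σ * (p σ)⁻¹.1 = (p σ)⁻¹.1 * f s := by
  rw [Units.mul_inv_eq_iff_eq_mul, mul_assoc, ← p.mul_map_apply, Units.inv_mul_cancel_left]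

/-- Multiplication of a lift by scalars. -/
def rescale (e : Gal(L/F) → Lˣ) (he : ∀ᶠ σ in 𝓝 1, e σ = 1) : GaloisLift f where
  toFun σ := e σ • p σ
  factor σ τ := e σ * σ • e τ * (e (σ * τ))⁻¹ * p.factor σ τ
  mul_map' σ τ := by
    have h : σ (e τ) = ((σ • e τ : Lˣ) : L) := rfl
    simp only [Units.val_smul, Units.smul_def, map_galois_smul, smul_mul_smul_comm, mul_map,
      smul_smul, h, ← Units.val_mul]
    congr 2
    rw [mul_right_comm _ _ (e (σ * τ)), inv_mul_cancel_right]
  eventually_eq_one := by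
    filter_upwards [p.eventually_eq_one, he] with σ h h'
    rw [h, h', one_smul]
  mul_map_apply' σ s := by
    simp only [Units.val_smul, Units.smul_def, smul_mul_assoc, mul_smul_comm, mul_map_apply]

/-- The Kronecker product of two lifts. -/
def kronecker : GaloisLift (kroneckerHom f g) where
  toFun σ := GeneralLinearGroup.kronecker (p σ) (q σ)
  factor σ τ := p.factor σ τ * q.factor σ τ
  mul_map' σ τ := by
    have hmap : ((p τ).1 ⊗ₖ (q τ).1).map σ = (p τ).1.map σ ⊗ₖ (q τ).1.map σ :=
      Matrix.ext fun _ _ => map_mul σ _ _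
    change (p σ).1 ⊗ₖ (q σ).1 * ((p τ).1 ⊗ₖ (q τ).1).map σ =
      ((p.factor σ τ : L) * (q.factor σ τ : L)) • ((p (σ * τ)).1 ⊗ₖ (q (σ * τ)).1)
    rw [hmap, ← mul_kronecker_mul, mul_map, mul_map, smul_kronecker, kronecker_smul, smul_smul]
  eventually_eq_one := by
    filter_upwards [p.eventually_eq_one, q.eventually_eq_one] with σ h h'
    refine Units.ext ?_
    change (p σ).1 ⊗ₖ (q σ).1 = 1
    rw [h, h']
    exact one_kronecker_one
  mul_map_apply' σ z := by
    change (p σ).1 ⊗ₖ (q σ).1 * _ = _ * (p σ).1 ⊗ₖ (q σ).1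
    induction z with
    | zero => rw [map_zero, Matrix.map_zero _ (map_zero σ), mul_zero, zero_mul]
    | add z w hz hw => rw [map_add, Matrix.map_add _ (map_add σ), mul_add, add_mul, hz, hw]
    | tmul s s' =>
      have hmap : (f s ⊗ₖ g s').map σ = (f s).map σ ⊗ₖ (g s').map σ :=
        Matrix.ext fun _ _ => map_mul σ _ _
      rw [kroneckerHom_tmul, hmap, ← mul_kronecker_mul, ← mul_kronecker_mul, mul_map_apply,
        mul_map_apply]

/-- The contragredient lift, for the opposite algebra. -/
def transpose : GaloisLift (transposeHom f) where
  toFun σ := ⟨(p σ)⁻¹.1ᵀ, (p σ).1ᵀ, by rw [← transpose_mul, Units.mul_inv, transpose_one],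
    by rw [← transpose_mul, Units.inv_mul, transpose_one]⟩
  factor σ τ := (p.factor σ τ)⁻¹
  mul_map' σ τ := by
    change (p σ)⁻¹.1ᵀ * (p τ)⁻¹.1ᵀ.map σ = _ • (p (σ * τ))⁻¹.1ᵀ
    rw [transpose_map, ← transpose_mul, ← transpose_smul]
    congr 1
    have hmap {A B : Matrix ι ι L} (h : A * B = 1) : A.map σ * B.map σ = 1 := by
      rw [← map_galois_mul, h, map_galois_one]
    rw [Units.mul_inv_eq_iff_eq_mul]
    refine (left_inv_eq_right_inv ?_ (hmap (p τ).mul_inv)).symm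
    rw [Matrix.mul_assoc, mul_map, smul_mul_smul_comm, Units.inv_mul, Units.inv_mul, one_smul]
  eventually_eq_one := by
    filter_upwards [p.eventually_eq_one] with σ h
    refine Units.ext ?_
    simp [h]
  mul_map_apply' σ s := by
    change (p σ)⁻¹.1ᵀ * ((f s.unop)ᵀ).map σ = (f s.unop)ᵀ * (p σ)⁻¹.1ᵀ
    rw [transpose_map, ← transpose_mul, ← transpose_mul]
    rw [map_apply_mul_inv]

/-- The tensor power of a lift. -/
def tensorPower (m : ℕ) : GaloisLift (piKroneckerHom m f) where
  toFun σ := ⟨piKronecker F ι m fun _ => (p σ).1, piKronecker F ι m fun _ => (p σ)⁻¹.1,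
    by
      rw [← piKronecker_mul, ← piKronecker_one (F := F) m]
      exact congrArg _ (funext fun _ => Units.mul_inv _),
    by
      rw [← piKronecker_mul, ← piKronecker_one (F := F) m]
      exact congrArg _ (funext fun _ => Units.inv_mul _)⟩
  factor σ τ := p.factor σ τ ^ m
  mul_map' σ τ := by
    dsimp only
    rw [map_piKronecker, ← piKronecker_mul, Units.val_pow_eq_pow_val, ← piKronecker_smul_const]
    exact congrArg _ (funext fun _ => p.mul_map σ τ)
  eventually_eq_one := by
    filter_upwards [p.eventually_eq_one] with σ h
    refine Units.ext ?_
    change piKronecker F ι m (fun _ => (p σ).1) = 1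
    rw [h]
    exact piKronecker_one m
  mul_map_apply' σ z := by
    dsimp only
    induction z using PiTensorProduct.induction_on with
    | add z w hz hw => rw [map_add, Matrix.map_add _ (map_add σ), mul_add, add_mul, hz, hw]
    | smul_tprod r s =>
      have hmap : (r • piKronecker F ι m fun i => f (s i)).map σ =
          r • piKronecker F ι m fun i => (f (s i)).map σ := by
        rw [← map_piKronecker]
        exact Matrix.ext fun _ _ => map_smul σ _ _
      rw [map_smul, piKroneckerHom_tprod, hmap, mul_smul_comm, smul_mul_assoc, ← piKronecker_mul,
        ← piKronecker_mul]
      exact congrArg _ (congrArg _ (funext fun i => p.mul_map_apply σ (s i)))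

/-- The trivial lift, for an isomorphism with a matrix algebra over the base field. -/
def ofAlgEquiv (e : S ≃ₐ[F] Matrix ι ι F) :
    GaloisLift ((Algebra.ofId F L).mapMatrix.comp (e : S →ₐ[F] Matrix ι ι F)) where
  toFun _ := 1
  factor _ _ := 1
  mul_map' σ _ := by simp
  eventually_eq_one := Filter.Eventually.of_forall fun _ => rfl
  mul_map_apply' σ s := by
    ext i j
    simp [Algebra.ofId_apply]

/-- The pullback of a lift along a homomorphism. -/
def comp (h : S' →ₐ[F] S) : GaloisLift (f.comp h) where
  toFun := p
  factor := p.factor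
  mul_map' := p.mul_map
  eventually_eq_one := p.eventually_eq_one
  mul_map_apply' σ s := p.mul_map_apply σ (h s)

variable [Algebra.IsIntegral F L] [Nonempty ι] {g : S →ₐ[F] Matrix κ κ L} (q : GaloisLift g)

theorem exists_mul_map_eq_smul (hf : IsForm L f) {P : Matrix ι κ L} {Q : Matrix κ ι L}
    (hPQ : P * Q = 1) (hQP : Q * P = 1) (hP : ∀ s, f s * P = P * g s) :
    ∃ e : Gal(L/F) → Lˣ, (∀ᶠ σ in 𝓝 1, e σ = 1) ∧
      ∀ σ, (p σ).1 * P.map σ = (e σ : L) • (P * (q σ).1) := by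
  have hR (σ : Gal(L/F)) (s : S) : f s * ((p σ).1 * P.map σ * (q σ)⁻¹.1) =
      (p σ).1 * P.map σ * (q σ)⁻¹.1 * g s := by
    have h : (f s).map σ * P.map σ = P.map σ * (g s).map σ := by
      rw [← map_galois_mul, hP, map_galois_mul]
    calc f s * ((p σ).1 * P.map σ * (q σ)⁻¹.1)
        = (p σ).1 * ((f s).map σ * P.map σ) * (q σ)⁻¹.1 := by
          simp only [← Matrix.mul_assoc, ← p.mul_map_apply]
      _ = (p σ).1 * P.map σ * ((g s).map σ * (q σ)⁻¹.1) := by simp only [h, Matrix.mul_assoc]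
      _ = (p σ).1 * P.map σ * (q σ)⁻¹.1 * g s := by
          simp only [q.map_apply_mul_inv, Matrix.mul_assoc]
  have hR0 (σ : Gal(L/F)) : (p σ).1 * P.map σ * (q σ)⁻¹.1 ≠ 0 := by
    intro h
    have hmap : P.map σ * Q.map σ = 1 := by rw [← map_galois_mul, hPQ, map_galois_one]
    refine one_ne_zero (α := Matrix ι ι L) ?_
    calc 1 = (p σ).1 * (P.map σ * ((q σ)⁻¹.1 * (q σ).1) * Q.map σ) * (p σ)⁻¹.1 := by
          rw [Units.inv_mul, Matrix.mul_one, hmap, Matrix.mul_one, Units.mul_inv]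
      _ = (p σ).1 * P.map σ * (q σ)⁻¹.1 * ((q σ).1 * Q.map σ * (p σ)⁻¹.1) := by
          simp only [Matrix.mul_assoc]
      _ = 0 := by rw [h, Matrix.zero_mul]
  choose e he using fun σ => hf.exists_eq_smul hPQ hQP hP (hR σ) (hR0 σ)
  have he' (σ : Gal(L/F)) : (p σ).1 * P.map σ = (e σ : L) • (P * (q σ).1) := by
    rw [← Matrix.smul_mul, ← he, Matrix.mul_assoc, Units.inv_mul, Matrix.mul_one]
  have hP0 : P ≠ 0 := fun h => zero_ne_one ((Matrix.zero_mul Q).symm.trans (h ▸ hPQ))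
  refine ⟨e, ?_, he'⟩
  filter_upwards [p.eventually_eq_one, q.eventually_eq_one, eventually_map_eq P] with σ hp hq hPσ
  refine Units.ext (smul_left_injective L hP0 ?_)
  simpa [hp, hq, hPσ, eq_comm] using he' σ

theorem exists_factor_eq (hf : IsForm L f) (hg : IsForm L g) :
    ∃ e : Gal(L/F) → Lˣ, (∀ᶠ σ in 𝓝 1, e σ = 1) ∧
      ∀ σ τ, e σ * σ • e τ * q.factor σ τ = p.factor σ τ * e (σ * τ) := by
  obtain ⟨P, Q, hPQ, hQP, hP⟩ := hf.exists_conj hg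
  obtain ⟨e, he, hpe⟩ := p.exists_mul_map_eq_smul q hf hPQ hQP hP
  refine ⟨e, he, fun σ τ => Units.ext (smul_left_injective L (m := P * (q (σ * τ)).1) ?_ ?_)⟩
  · intro h
    refine one_ne_zero (α := Matrix ι ι L) ?_
    rw [← hPQ, ← Matrix.mul_one P, ← (q (σ * τ)).mul_inv, ← Matrix.mul_assoc, h, Matrix.zero_mul,
      Matrix.zero_mul]
  · have hcomp : P.map (σ * τ) = (P.map τ).map σ := rfl
    have hσ : σ (e τ : L) = ((σ • e τ : Lˣ) : L) := rfl
    calc ((e σ * σ • e τ * q.factor σ τ : Lˣ) : L) • (P * (q (σ * τ)).1)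
        = (p σ).1 * ((e τ : L) • (P * (q τ).1)).map σ := by
          rw [map_galois_smul, map_galois_mul, Matrix.mul_smul, ← Matrix.mul_assoc, hpe,
            Matrix.smul_mul, Matrix.mul_assoc, q.mul_map, Matrix.mul_smul, smul_smul, smul_smul, hσ,
            ← Units.val_mul, ← Units.val_mul, mul_comm (σ • e τ)]
      _ = (p σ).1 * (p τ).1.map σ * P.map (σ * τ) := by
          rw [← hpe, map_galois_mul, hcomp, Matrix.mul_assoc]
      _ = ((p.factor σ τ * e (σ * τ) : Lˣ) : L) • (P * (q (σ * τ)).1) := by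
          rw [p.mul_map, Matrix.smul_mul, hpe, smul_smul, Units.val_mul]

end GaloisLift

end GaloisLift

section HasCoboundary

open Topology Matrix
open scoped Kronecker

variable {F L : Type*} [Field F] [Field L] [Algebra F L] {Y G : Type*} [Group G] [MulAction G Y]

/-- The cochain `u` with values in the functions `Y → Lˣ`, on which the Galois group acts through
its action on `Lˣ` and the permutations `γ` of `Y`, has the constant coboundary `a`. -/
structure HasCoboundary (γ : Gal(L/F) →* G) (u : Gal(L/F) → Y → Lˣ)
    (a : Gal(L/F) → Gal(L/F) → Lˣ) : Prop where
  eventually_eq_one : ∀ᶠ σ in 𝓝 1, u σ = 1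
  mul_smul : ∀ σ τ y, u σ y * σ • u τ ((γ σ)⁻¹ • y) = a σ τ * u (σ * τ) y

variable {γ : Gal(L/F) →* G} {S ι : Type*} [Ring S] [Algebra F S] [Fintype ι] [DecidableEq ι]
  {f : S →ₐ[F] Matrix ι ι L} (p : GaloisLift f) {u : Gal(L/F) → Y → Lˣ}

theorem HasCoboundary.rescale (hu : HasCoboundary γ u p.factor) (e : Gal(L/F) → Lˣ)
    (he : ∀ᶠ σ in 𝓝 1, e σ = 1) :
    HasCoboundary γ (fun σ y => e σ * u σ y) (p.rescale e he).factor where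
  eventually_eq_one := by
    filter_upwards [hu.eventually_eq_one, he] with σ h h'
    funext y
    simp only [h, h', Pi.one_apply, mul_one]
  mul_smul σ τ y := by
    change _ = e σ * σ • e τ * (e (σ * τ))⁻¹ * p.factor σ τ * (e (σ * τ) * u (σ * τ) y)
    rw [smul_mul', mul_mul_mul_comm, hu.mul_smul, mul_assoc _ (p.factor σ τ),
      mul_left_comm (p.factor σ τ), mul_assoc _ (e (σ * τ))⁻¹, inv_mul_cancel_left, mul_assoc]

theorem HasCoboundary.exists_isEquivariantFamily [IsGalois F L] [Finite Y]
    (hγ : ∀ᶠ σ in 𝓝 1, γ σ = 1) (hf : IsForm L f) (hu : HasCoboundary γ u p.factor) :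
    ∃ θ : Y → S →ₐ[F] Matrix ι ι L, IsEquivariantFamily γ θ := by
  obtain ⟨N, hN⟩ := exists_invariant_matrix γ hγ (fun σ y => ((u σ y)⁻¹ : L) • (p σ).1)
    (fun σ τ y => by
      rw [map_galois_smul, smul_mul_smul_comm, p.mul_map, smul_smul]
      have h := congrArg Units.val (hu.mul_smul σ τ y)
      simp only [Units.val_mul] at h
      have hσ : ((σ • u τ ((γ σ)⁻¹ • y) : Lˣ) : L) = σ (u τ ((γ σ)⁻¹ • y)) := rfl
      congr 1
      rw [map_inv₀, ← hσ, ← mul_inv, h, mul_inv, mul_right_comm,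
        inv_mul_cancel₀ (Units.ne_zero _), one_mul])
    (by
      filter_upwards [hu.eventually_eq_one, p.eventually_eq_one] with σ h h'
      rw [h, h']
      funext y
      simp)
  let conj (y : Y) : Matrix ι ι L ≃ₐ[L] Matrix ι ι L :=
    MulSemiringAction.toAlgEquiv L _ (ConjAct.toConjAct (N y)⁻¹)
  have hconj (y : Y) (M : Matrix ι ι L) : conj y M = (N y)⁻¹.1 * M * (N y).1 := by
    change (ConjAct.toConjAct (N y)⁻¹) • M = _
    rw [ConjAct.units_smul_def, ConjAct.ofConjAct_toConjAct, inv_inv]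
  refine ⟨fun y => (((conj y).restrictScalars F : Matrix ι ι L →ₐ[F] Matrix ι ι L)).comp f,
    fun y => hf.comp_algEquiv (conj y), fun σ y s => ?_⟩
  change conj _ (f s) = (conj y (f s)).map σ
  rw [hconj, hconj, mul_assoc, Units.inv_mul_eq_iff_eq_mul, map_galois_mul, map_galois_mul]
  have h := hN σ (γ σ • y)
  rw [inv_smul_smul] at h
  have hinv : (N y).1.map σ * (N y)⁻¹.1.map σ = 1 := by
    rw [← map_galois_mul, Units.mul_inv, map_galois_one]
  rw [← h]
  simp only [smul_mul_assoc, mul_smul_comm]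
  congr 1
  calc f s * ((p σ).1 * (N y).1.map σ) = (p σ).1 * (f s).map σ * (N y).1.map σ := by
        rw [p.mul_map_apply, mul_assoc]
    _ = (p σ).1 * ((N y).1.map σ * (N y)⁻¹.1.map σ) * (f s).map σ * (N y).1.map σ := by
        rw [hinv, mul_one]
    _ = _ := by simp only [mul_assoc]

theorem GaloisLift.isSplit_of_factor_eq_one [IsGalois F L] [Nonempty ι] [Module.Finite F S]
    (hf : IsForm L f) (hp : p.factor = 1) : IsSplit F S := by
  obtain ⟨θ, hθ⟩ := HasCoboundary.exists_isEquivariantFamily (Y := Unit) (u := 1) p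
    (γ := (1 : Gal(L/F) →* Unit)) (Filter.Eventually.of_forall fun _ => rfl) hf
    ⟨Filter.Eventually.of_forall fun _ => rfl, fun σ τ y => by simp [hp]⟩
  exact hθ.isSplit_of_unit

theorem IsEquivariantFamily.exists_intertwiners {θ : Y → S →ₐ[F] Matrix ι ι L}
    (hθ : IsEquivariantFamily γ θ) (z : Y) :
    ∃ Q : Y → GL ι L, Q z = 1 ∧ ∀ y s, θ y s * (Q y).1 = (Q y).1 * θ z s := by
  choose P P' hPP' hP'P hP using fun y => (hθ.isForm y).exists_conj (hθ.isForm z)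
  let U (y : Y) : GL ι L := ⟨P y, P' y, hPP' y, hP'P y⟩
  refine ⟨fun y => U y * (U z)⁻¹, mul_inv_cancel _, fun y s => ?_⟩
  have hinv : θ z s * (U z)⁻¹.1 = (U z)⁻¹.1 * θ z s := by
    rw [Units.mul_inv_eq_iff_eq_mul, mul_assoc, Units.eq_inv_mul_iff_mul_eq]
    exact (hP z s).symm
  rw [Units.val_mul, mul_assoc, ← hinv, ← mul_assoc, ← mul_assoc]
  exact congrArg (· * _) (hP y s)

theorem IsEquivariantFamily.exists_smul_map_eq [Nonempty ι] {θ : Y → S →ₐ[F] Matrix ι ι L}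
    (hθ : IsEquivariantFamily γ θ) {z : Y} {Q : Y → GL ι L}
    (hQ : ∀ y s, θ y s * (Q y).1 = (Q y).1 * θ z s) (σ : Gal(L/F)) (y : Y) :
    ∃ a : Lˣ, (Q y * (Q (γ σ • z))⁻¹).1 = (a : L) • (Q ((γ σ)⁻¹ • y)).1.map σ := by
  have hinv (s : S) : θ z s * (Q (γ σ • z))⁻¹.1 = (Q (γ σ • z))⁻¹.1 * θ (γ σ • z) s := by
    rw [Units.mul_inv_eq_iff_eq_mul, mul_assoc, hQ, Units.inv_mul_cancel_left]
  refine (hθ.isForm y).exists_eq_smul (g := θ (γ σ • z))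
    (Q := (Q ((γ σ)⁻¹ • y))⁻¹.1.map σ) ?_ ?_ (fun s => ?_) (fun s => ?_) (Units.ne_zero _)
  · rw [← map_galois_mul, Units.mul_inv, map_galois_one]
  · rw [← map_galois_mul, Units.inv_mul, map_galois_one]
  · conv_lhs => rw [← smul_inv_smul (γ σ) y, hθ.apply_smul]
    rw [smul_inv_smul, hθ.apply_smul, ← map_galois_mul, hQ, map_galois_mul]
  · rw [Units.val_mul, ← mul_assoc, hQ, mul_assoc, hinv, mul_assoc]

theorem IsEquivariantFamily.exists_hasCoboundary [Algebra.IsIntegral F L] [Finite Y] [Nonempty ι]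
    (hγ : ∀ᶠ σ in 𝓝 1, γ σ = 1) {θ : Y → S →ₐ[F] Matrix ι ι L} (hθ : IsEquivariantFamily γ θ)
    (z : Y) : ∃ (p : GaloisLift (θ z)) (u : Gal(L/F) → Y → Lˣ), HasCoboundary γ u p.factor := by
  obtain ⟨Q, hQz, hQ⟩ := hθ.exists_intertwiners z
  choose u hu using hθ.exists_smul_map_eq hQ
  have hmul (σ τ : Gal(L/F)) (y : Y) : (Q (γ σ • z))⁻¹.1 * (Q (γ τ • z))⁻¹.1.map σ =
      ((u σ y * σ • u τ ((γ σ)⁻¹ • y) * (u (σ * τ) y)⁻¹ : Lˣ) : L) •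
        (Q (γ (σ * τ) • z))⁻¹.1 := by
    have hcomp (M : Matrix ι ι L) : (M.map τ).map σ = M.map (σ * τ) := rfl
    have hσ : σ (u τ ((γ σ)⁻¹ • y)) = ((σ • u τ ((γ σ)⁻¹ • y) : Lˣ) : L) := rfl
    have hστ : (γ τ)⁻¹ • (γ σ)⁻¹ • y = (γ (σ * τ))⁻¹ • y := by
      rw [map_mul, _root_.mul_inv_rev, mul_smul]
    rw [← Units.mul_right_inj (Q y)]
    calc (Q y).1 * ((Q (γ σ • z))⁻¹.1 * (Q (γ τ • z))⁻¹.1.map σ)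
        = (u σ y : L) • (Q ((γ σ)⁻¹ • y) * (Q (γ τ • z))⁻¹).1.map σ := by
          rw [← mul_assoc, ← Units.val_mul, hu, smul_mul_assoc, ← map_galois_mul, Units.val_mul]
      _ = ((u σ y * σ • u τ ((γ σ)⁻¹ • y) : Lˣ) : L) • (Q ((γ (σ * τ))⁻¹ • y)).1.map (σ * τ) := by
          rw [hu, map_galois_smul, smul_smul, hσ, ← Units.val_mul, hcomp, hστ]
      _ = _ := by
          rw [Matrix.mul_smul, ← Units.val_mul (Q y), hu, smul_smul, ← Units.val_mul,
            inv_mul_cancel_right]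
  have hone : ∀ᶠ σ in 𝓝 1, (Q (γ σ • z))⁻¹ = 1 := by
    filter_upwards [hγ] with σ h
    rw [h, one_smul, hQz, inv_one]
  refine ⟨⟨fun σ => (Q (γ σ • z))⁻¹,
    fun σ τ => u σ z * σ • u τ ((γ σ)⁻¹ • z) * (u (σ * τ) z)⁻¹, fun σ τ => hmul σ τ z, hone,
    fun σ s => ?_⟩, u, ?_, fun σ τ y => ?_⟩
  · rw [← hθ.apply_smul, Units.inv_mul_eq_iff_eq_mul, ← mul_assoc, ← hQ, mul_assoc, Units.mul_inv,
      mul_one]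
  · filter_upwards [hγ, Filter.eventually_all.2 fun y => eventually_map_eq (Q y).1] with σ h hσ
    refine funext fun y => Units.ext (smul_left_injective L (Units.ne_zero (Q y)) ?_)
    simpa [h, hσ, hQz] using (hu σ y).symm
  · rw [← mul_inv_eq_iff_eq_mul]
    exact Units.ext (smul_left_injective L (Units.ne_zero _)
      ((hmul σ τ y).symm.trans (hmul σ τ z)))

theorem exists_units_pow_eq [IsSepClosed L] {m : ℕ} (hm : (m : L) ≠ 0) (a : Lˣ) :
    ∃ r : Lˣ, r ^ m = a := by
  have : NeZero (m : L) := ⟨hm⟩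
  obtain ⟨r, hr⟩ := IsSepClosed.exists_pow_nat_eq (a : L) m
  have hr0 : r ≠ 0 := by
    rintro rfl
    exact a.ne_zero (by rw [← hr, zero_pow (by rintro rfl; simp at hm)])
  exact ⟨.mk0 r hr0, Units.ext hr⟩

theorem exists_matrix_equiv_of_isSplit {A B : Type*} [Ring A] [Algebra F A] [Ring B] [Algebra F B]
    (h : IsSplit F (A ⊗[F] Bᵐᵒᵖ)) (h' : IsSplit F (B ⊗[F] Bᵐᵒᵖ)) :
    ∃ k l : ℕ, k ≠ 0 ∧ l ≠ 0 ∧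
      Nonempty (Matrix (Fin k) (Fin k) A ≃ₐ[F] Matrix (Fin l) (Fin l) B) := by
  obtain ⟨l, hl, ⟨e⟩⟩ := h
  obtain ⟨k, hk, ⟨e'⟩⟩ := h'
  exact ⟨k, l, hk, hl, ⟨(matrixEquivTensor (Fin k) F A).trans <|
    (Algebra.TensorProduct.congr AlgEquiv.refl
      (e'.symm.trans (Algebra.TensorProduct.comm F B Bᵐᵒᵖ))).trans <|
    (Algebra.TensorProduct.assoc F F F A Bᵐᵒᵖ B).symm.trans <|
    (Algebra.TensorProduct.congr e AlgEquiv.refl).trans <|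
    (Algebra.TensorProduct.comm F _ B).trans (matrixEquivTensor (Fin l) F B).symm⟩⟩

namespace GaloisLift

variable [IsGalois F L] [Nonempty ι] [Module.Finite F S]

theorem exists_matrix_equiv {S' κ : Type*} [Ring S'] [Algebra F S'] [Module.Finite F S'] [Fintype κ]
    [DecidableEq κ] [Nonempty κ] {g : S' →ₐ[F] Matrix κ κ L} (q : GaloisLift g) (hf : IsForm L f)
    (hg : IsForm L g) (h : p.factor = q.factor) :
    ∃ k l : ℕ, k ≠ 0 ∧ l ≠ 0 ∧
      Nonempty (Matrix (Fin k) (Fin k) S ≃ₐ[F] Matrix (Fin l) (Fin l) S') :=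
  exists_matrix_equiv_of_isSplit
    ((p.kronecker q.transpose).isSplit_of_factor_eq_one (hf.kroneckerHom hg.transposeHom)
      (funext₂ fun σ τ => mul_inv_eq_one.2 (congrFun₂ h σ τ)))
    ((q.kronecker q.transpose).isSplit_of_factor_eq_one (hg.kroneckerHom hg.transposeHom)
      (funext₂ fun _ _ => mul_inv_cancel _))

theorem isSplit_piTensorProduct (hf : IsForm L f) {m : ℕ} (e : Gal(L/F) → Lˣ)
    (he : ∀ᶠ σ in 𝓝 1, e σ = 1) (h : ∀ σ τ, e σ * σ • e τ * p.factor σ τ ^ m = e (σ * τ)) :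
    IsSplit F (⨂[F] _ : Fin m, S) := by
  refine ((p.tensorPower m).rescale e he).isSplit_of_factor_eq_one (hf.piKroneckerHom m)
    (funext₂ fun σ τ => ?_)
  change e σ * σ • e τ * (e (σ * τ))⁻¹ * p.factor σ τ ^ m = 1
  rw [mul_right_comm, h, mul_inv_cancel]

omit [Nonempty ι] in
theorem exists_rescale_factor_pow_eq_one [IsSepClosed L] {m : ℕ} (hm : (m : L) ≠ 0)
    (hf : IsForm L f) (hS : IsSplit F (⨂[F] _ : Fin m, S)) :
    ∃ (e : Gal(L/F) → Lˣ) (he : ∀ᶠ σ in 𝓝 1, e σ = 1), (p.rescale e he).factor ^ m = 1 := by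
  obtain ⟨d, hd, ⟨φ⟩⟩ := hS
  have : NeZero d := ⟨hd⟩
  obtain ⟨e, he, hfactor⟩ := (ofAlgEquiv (L := L) φ).exists_factor_eq (p.tensorPower m)
    ((isForm_ofId.mapMatrix).comp_algEquiv_left φ) (hf.piKroneckerHom m)
  have hroot (a : Lˣ) : ∃ r : Lˣ, r ^ m = a ∧ (a = 1 → r = 1) := by
    by_cases ha : a = 1
    · exact ⟨1, by rw [one_pow, ha], fun _ => rfl⟩
    · obtain ⟨r, hr⟩ := exists_units_pow_eq hm a
      exact ⟨r, hr, fun h => absurd h ha⟩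
  choose r hr hr1 using hroot
  refine ⟨fun σ => r (e σ), he.mono fun σ h => hr1 _ h, funext₂ fun σ τ => ?_⟩
  change (r (e σ) * σ • r (e τ) * (r (e (σ * τ)))⁻¹ * p.factor σ τ) ^ m = 1
  have h : e σ * σ • e τ * p.factor σ τ ^ m = e (σ * τ) := (hfactor σ τ).trans (one_mul _)
  rw [mul_right_comm, mul_pow, mul_pow, mul_pow, ← smul_pow', inv_pow, hr, hr, hr, h,
    mul_inv_cancel]

end GaloisLift

end HasCoboundary

/-! ### Galois algebras and homomorphisms of the Galois group -/

section TensorAction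

variable {F L E G : Type*} [Field F] [Field L] [Algebra F L] [CommRing E] [Algebra F E]
  [Group G] [MulSemiringAction G E] [SMulCommClass G F E]

/-- The action of `G` on `L ⊗ E` through `E`. -/
@[reducible]
def tensorAction : MulSemiringAction G (L ⊗[F] E) where
  smul g z := Algebra.TensorProduct.map (AlgHom.id L L) (MulSemiringAction.toAlgHom F E g) z
  one_smul z := by
    change Algebra.TensorProduct.map (AlgHom.id L L) (MulSemiringAction.toAlgHom F E (1 : G)) z = z
    rw [show MulSemiringAction.toAlgHom F E (1 : G) = AlgHom.id F E from AlgHom.ext (one_smul G),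
      Algebra.TensorProduct.map_id, AlgHom.id_apply]
  mul_smul g h z := by
    change Algebra.TensorProduct.map (AlgHom.id L L) (MulSemiringAction.toAlgHom F E (g * h)) z =
      Algebra.TensorProduct.map (AlgHom.id L L) (MulSemiringAction.toAlgHom F E g)
        (Algebra.TensorProduct.map (AlgHom.id L L) (MulSemiringAction.toAlgHom F E h) z)
    rw [← AlgHom.comp_apply, ← Algebra.TensorProduct.map_comp, AlgHom.id_comp]
    exact DFunLike.congr_fun (congrArg (Algebra.TensorProduct.map (AlgHom.id L L))
      (AlgHom.ext (mul_smul g h))) z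
  smul_zero g := map_zero _
  smul_add g := map_add _
  smul_one g := map_one _
  smul_mul g := map_mul _

attribute [local instance] tensorAction

theorem smul_tmul_eq (g : G) (a : L) (x : E) : g • (a ⊗ₜ[F] x) = a ⊗ₜ (g • x) := rfl

theorem isInvariant_tensor [Algebra.IsInvariant F E G] : Algebra.IsInvariant L (L ⊗[F] E) G where
  isInvariant z hz := by
    classical
    let b := Module.Basis.ofVectorSpace F L
    let coord := TensorProduct.equivFinsuppOfBasisLeft (N := E) b
    have hcoord (g : G) (z : L ⊗[F] E) (i) : coord (g • z) i = g • coord z i := by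
      induction z with
      | zero => simp
      | add x y hx hy => simp only [smul_add, map_add, Finsupp.add_apply, hx, hy]
      | tmul a x => simp [coord, smul_tmul_eq, smul_comm g]
    choose r hr using fun i => Algebra.IsInvariant.isInvariant (A := F) (G := G) (coord z i)
      fun g => by rw [← hcoord, hz]
    have hsum : z = ∑ i ∈ (coord z).support, b i ⊗ₜ[F] coord z i := by
      conv_lhs => rw [← coord.symm_apply_apply z]
      rw [TensorProduct.equivFinsuppOfBasisLeft_symm_apply]
      rfl
    refine ⟨∑ i ∈ (coord z).support, r i • b i, ?_⟩
    conv_rhs => rw [hsum]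
    rw [map_sum]
    refine Finset.sum_congr rfl fun i _ => ?_
    rw [← hr, Algebra.TensorProduct.algebraMap_apply, Algebra.algebraMap_self_apply,
      TensorProduct.smul_tmul, Algebra.algebraMap_eq_smul_one]

theorem exists_smul_algHom [Finite G] [Algebra.IsInvariant F E G] (φ ψ : E →ₐ[F] L) :
    ∃ g : G, ∀ x, ψ x = φ (g • x) := by
  have := isInvariant_tensor (F := F) (L := L) (E := E) (G := G)
  have : SMulCommClass G L (L ⊗[F] E) := ⟨fun g a z => map_smul
    (Algebra.TensorProduct.map (AlgHom.id L L) (MulSemiringAction.toAlgHom F E g)) a z⟩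
  let P := RingHom.ker (extendScalars L φ)
  let Q := RingHom.ker (extendScalars L ψ)
  have hP : P.IsPrime := RingHom.ker_isPrime _
  have hQ : Q.IsPrime := RingHom.ker_isPrime _
  obtain ⟨g, hg⟩ := Algebra.IsInvariant.exists_smul_of_under_eq L (L ⊗[F] E) G P Q (by
    ext a
    simp [P, Q, Ideal.mem_comap, extendScalars_tmul])
  refine ⟨g⁻¹, fun x => ?_⟩
  have hx : (1 : L) ⊗ₜ[F] x - algebraMap L _ (ψ x) ∈ Q := by
    simp [Q, RingHom.mem_ker, extendScalars_tmul]
  rw [hg, Ideal.mem_pointwise_smul_iff_inv_smul_mem, smul_sub, smul_algebraMap, smul_tmul_eq,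
    RingHom.mem_ker, map_sub, AlgHom.commutes, extendScalars_tmul, one_smul, sub_eq_zero] at hx
  exact hx.symm

end TensorAction

section Etale

variable {F L E : Type u} [Field F] [Field L] [Algebra F L] [IsSepClosed L] [CommRing E]
  [Algebra F E] [Algebra.Etale F E]

/-- The homomorphism `E → L` attached to a point of `L ⊗ E`. -/
def pointHom (p : PrimeSpectrum (L ⊗[F] E)) : E →ₐ[F] L :=
  (((Pi.evalAlgHom L (fun _ => L) p).comp
    (Algebra.FormallyEtale.equivPiOfIsSepClosed L (L ⊗[F] E)).toAlgHom).restrictScalars F).comp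
      Algebra.TensorProduct.includeRight

theorem eq_zero_of_algHom (x : E) (h : ∀ φ : E →ₐ[F] L, φ x = 0) : x = 0 := by
  let e := Algebra.FormallyEtale.equivPiOfIsSepClosed L (L ⊗[F] E)
  have hx : (1 : L) ⊗ₜ[F] x = 0 :=
    e.injective ((funext fun p => h (pointHom p)).trans (map_zero e).symm)
  exact Algebra.TensorProduct.includeRight_injective
    (FaithfulSMul.algebraMap_injective F L) (by simpa using hx)

theorem pointHom_injective : Function.Injective (pointHom (F := F) (L := L) (E := E)) := by
  classical
  intro p q h
  let e := Algebra.FormallyEtale.equivPiOfIsSepClosed L (L ⊗[F] E)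
  have heval : (Pi.evalAlgHom L (fun _ => L) p).comp e.toAlgHom =
      (Pi.evalAlgHom L (fun _ => L) q).comp e.toAlgHom :=
    Algebra.TensorProduct.ext (by ext) h
  by_contra hpq
  have hsingle := DFunLike.congr_fun heval (e.symm (Pi.single p 1))
  simp [Pi.single_eq_of_ne (Ne.symm hpq)] at hsingle

theorem card_primeSpectrum_tensor :
    Nat.card (PrimeSpectrum (L ⊗[F] E)) = Module.finrank F E := by
  have : Module.Finite F E := Algebra.FormallyUnramified.finite_of_free F E
  have : IsArtinianRing (L ⊗[F] E) := isArtinian_of_tower L inferInstance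
  have := Fintype.ofFinite (PrimeSpectrum (L ⊗[F] E))
  rw [← Module.finrank_baseChange (R := L),
    (Algebra.FormallyEtale.equivPiOfIsSepClosed L (L ⊗[F] E)).toLinearEquiv.finrank_eq,
    Module.finrank_fintype_fun_eq_card, Nat.card_eq_fintype_card]

variable (L) in
theorem nonempty_algHom [Nontrivial E] : Nonempty (E →ₐ[F] L) := by
  obtain ⟨p⟩ : Nonempty (PrimeSpectrum (L ⊗[F] E)) := inferInstance
  exact ⟨pointHom p⟩

theorem bijective_smul_algHom {G : Type*} [Group G] [Finite G] [MulSemiringAction G E]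
    [SMulCommClass G F E] [Algebra.IsInvariant F E G] (hE : Module.finrank F E = Nat.card G)
    (φ : E →ₐ[F] L) :
    Function.Bijective fun g : G => φ.comp (MulSemiringAction.toAlgHom F E g) := by
  have hs : Function.Surjective fun g : G => φ.comp (MulSemiringAction.toAlgHom F E g) := by
    intro ψ
    obtain ⟨g, hg⟩ := exists_smul_algHom (G := G) φ ψ
    exact ⟨g, AlgHom.ext fun x => (hg x).symm⟩
  have : Finite (E →ₐ[F] L) := Finite.of_surjective _ hs
  have hcard := Nat.card_le_card_of_injective _ (pointHom_injective (F := F) (L := L) (E := E))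
  rw [card_primeSpectrum_tensor, hE] at hcard
  exact (Nat.bijective_iff_surjective_and_card _).2
    ⟨hs, le_antisymm hcard (Nat.card_le_card_of_surjective _ hs)⟩

end Etale

section GaloisAlgebraOfHom

open Topology

variable {F L : Type u} [Field F] [Field L] [Algebra F L] {G : Type} [Group G]

/-- The action of `G` on the twisted form of `F^G` by right translations. -/
instance twistFunAction (γ : Gal(L/F) →* G) : MulSemiringAction G (twistFun G γ) where
  smul g f := ⟨fun h => f.1 (h * g), fun σ h => by
    have := f.2 σ (h * g)
    rwa [smul_eq_mul, ← mul_assoc] at this⟩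
  one_smul f := Subtype.ext (funext fun h => congrArg f.1 (mul_one h))
  mul_smul g g' f := Subtype.ext (funext fun h => congrArg f.1 (mul_assoc h g g').symm)
  smul_zero g := rfl
  smul_add g f f' := rfl
  smul_one g := rfl
  smul_mul g f f' := rfl

theorem twistFun_smul_apply (γ : Gal(L/F) →* G) (g h : G) (f : twistFun G γ) :
    (g • f).1 h = f.1 (h * g) := rfl

theorem twistFun_smul_one (γ : Gal(L/F) →* G) (f : twistFun G γ) (h : G) : (h • f).1 1 = f.1 h :=
  congrArg f.1 (one_mul h)

variable [IsGalois F L]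

theorem isInvariant_twistFun (γ : Gal(L/F) →* G) : Algebra.IsInvariant F (twistFun G γ) G where
  isInvariant f hf := by
    have hconst (h : G) : f.1 h = f.1 1 := by
      simpa [twistFun_smul_apply] using congrArg (fun f : twistFun G γ => f.1 1) (hf h)
    obtain ⟨r, hr⟩ := (InfiniteGalois.mem_range_algebraMap_iff_fixed (k := F) (f.1 1)).2
      fun σ => by rw [← f.2 σ 1, hconst]
    exact ⟨r, Subtype.ext (funext fun h => hr.trans (hconst h).symm)⟩

variable [Finite G]

/-- The Galois `G`-algebra attached to a continuous homomorphism `Gal(L/F) → G`. -/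
def galoisAlgebraOfHom (γ : Gal(L/F) →* G) (hγ : ∀ᶠ σ in 𝓝 1, γ σ = 1) : GaloisAlgebra G F :=
  haveI := Fintype.ofFinite G
  haveI := Classical.decEq G
  { carrier := twistFun G γ
    smulComm := ⟨fun _ _ _ => rfl⟩
    etale := by
      have : Algebra.Etale L (L ⊗[F] twistFun G γ) :=
        Algebra.Etale.of_equiv (isForm_val_twistFun γ hγ).2.algEquiv.symm
      exact Algebra.Etale.of_etale_tensorProduct_of_faithfullyFlat L
    finrank_eq := by rw [finrank_twistFun γ hγ, Nat.card_eq_fintype_card]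
    invariant := isInvariant_twistFun γ }

omit [Finite G] in
theorem eq_of_twistFun {Y : Type*} [Finite Y] [MulAction G Y] (γ : Gal(L/F) →* G)
    (hγ : ∀ᶠ σ in 𝓝 1, γ σ = 1) {y y' : Y} (h : ∀ f : twistFun Y γ, f.1 y = f.1 y') : y = y' := by
  classical
  by_contra hy
  have hle : Submodule.span L (Set.range (twistFun Y γ).val) ≤
      LinearMap.ker (LinearMap.proj (R := L) (φ := fun _ => L) y - LinearMap.proj y') := by
    rw [Submodule.span_le]
    rintro _ ⟨f, rfl⟩
    exact sub_eq_zero.2 (h f)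
  rw [(isForm_val_twistFun γ hγ).2.span_range] at hle
  have hsingle := hle (Submodule.mem_top (x := Pi.single y (1 : L)))
  simp [Pi.single_eq_of_ne (Ne.symm hy)] at hsingle

theorem isConj_of_twistFun_equiv (γ γ' : Gal(L/F) →* G) (hγ : ∀ᶠ σ in 𝓝 1, γ σ = 1)
    (e : twistFun G γ ≃ₐ[F] twistFun G γ') (he : ∀ (g : G) x, e (g • x) = g • e x) :
    ∃ g : G, ∀ σ, γ' σ = g⁻¹ * γ σ * g := by
  have := isInvariant_twistFun γ
  have : SMulCommClass G F (twistFun G γ) := ⟨fun _ _ _ => rfl⟩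
  let evalOne (γ : Gal(L/F) →* G) : twistFun G γ →ₐ[F] L :=
    (Pi.evalAlgHom F (fun _ => L) 1).comp (twistFun G γ).val
  obtain ⟨g, hg⟩ := exists_smul_algHom (G := G) (evalOne γ) ((evalOne γ').comp e.toAlgHom)
  have htranslate (f : twistFun G γ) (h : G) : (e f).1 h = f.1 (g * h) := by
    have heval : (e (h • f)).1 1 = (h • f).1 (1 * g) := hg (h • f)
    rwa [he, twistFun_smul_apply, twistFun_smul_apply, one_mul, one_mul] at heval
  refine ⟨g, fun σ => ?_⟩
  rw [mul_assoc, eq_inv_mul_iff_mul_eq]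
  refine eq_of_twistFun γ hγ fun f => ?_
  calc f.1 (g * γ' σ) = (e f).1 (γ' σ • 1) := by rw [htranslate, smul_eq_mul, mul_one]
    _ = σ (f.1 g) := by rw [(e f).2, htranslate, mul_one]
    _ = f.1 (γ σ * g) := (f.2 σ g).symm

theorem exists_hom_of_algHom [IsSepClosed L] (E : GaloisAlgebra G F) (φ : E →ₐ[F] L) :
    ∃ (γ : Gal(L/F) →* G) (_ : ∀ᶠ σ in 𝓝 1, γ σ = 1), ∀ σ x, φ (γ σ • x) = σ (φ x) := by
  have hφ := bijective_smul_algHom (L := L) E.finrank_eq φ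
  have hinj {g h : G} (hgh : ∀ x, φ (g • x) = φ (h • x)) : g = h := hφ.1 (AlgHom.ext hgh)
  choose γ hγ using fun σ : Gal(L/F) => hφ.2 (σ.toAlgHom.comp φ)
  replace hγ (σ : Gal(L/F)) (x : E) : φ (γ σ • x) = σ (φ x) := DFunLike.congr_fun (hγ σ) x
  have : Module.Finite F E := Algebra.FormallyUnramified.finite_of_free F E
  let b := Module.finBasis F E
  refine ⟨{ toFun := γ
            map_one' := hinj fun x => by rw [hγ, one_smul, AlgEquiv.one_apply]
            map_mul' := fun σ τ => hinj fun x => by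
              rw [hγ, mul_smul, hγ, hγ, AlgEquiv.mul_apply] }, ?_, hγ⟩
  filter_upwards [eventually_comp_eq (F := F) fun i => φ (b i)] with σ hσ
  have hfixed : (σ.toAlgHom.comp φ).toLinearMap = φ.toLinearMap := b.ext hσ
  refine hinj fun x => ?_
  rw [one_smul]
  exact (hγ σ x).trans (LinearMap.congr_fun hfixed x)

omit [IsGalois F L] [Finite G] in
/-- The homomorphism `x ↦ (h ↦ φ (h • x))` to the form of `F^G` twisted by the homomorphism `γ`
through which the Galois group acts on the `G`-orbit of `φ`. -/
def orbitHom (E : GaloisAlgebra G F) (φ : E →ₐ[F] L) (γ : Gal(L/F) →* G)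
    (hγ : ∀ σ x, φ (γ σ • x) = σ (φ x)) : E →ₐ[F] twistFun G γ :=
  (AlgHom.pi fun h : G => φ.comp (MulSemiringAction.toAlgHom F E h)).codRestrict (twistFun G γ)
    fun x σ h => by
      change φ ((γ σ * h) • x) = σ (φ (h • x))
      rw [mul_smul, hγ]

theorem exists_equiv_twistFun [IsSepClosed L] (E : GaloisAlgebra G F) :
    ∃ (γ : Gal(L/F) →* G) (_ : ∀ᶠ σ in 𝓝 1, γ σ = 1) (e : E ≃ₐ[F] twistFun G γ),
      ∀ (g : G) (x : E) (h : G), (e (g • x)).1 h = (e x).1 (h * g) := by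
  have := Fintype.ofFinite G
  have : Module.Finite F E := Algebra.FormallyUnramified.finite_of_free F E
  have : Nontrivial E := Module.nontrivial_of_finrank_pos (R := F) (E.finrank_eq ▸ Nat.card_pos)
  obtain ⟨φ⟩ := nonempty_algHom (F := F) L (E := E)
  obtain ⟨γ, hγ, hφ⟩ := exists_hom_of_algHom E φ
  have := (isForm_val_twistFun (Y := G) γ hγ).1
  have hinj : Function.Injective (orbitHom E φ γ hφ) := by
    rw [injective_iff_map_eq_zero]
    intro x hx
    refine eq_zero_of_algHom (F := F) (L := L) x fun ψ => ?_
    obtain ⟨g, rfl⟩ := (bijective_smul_algHom (L := L) E.finrank_eq φ).2 ψ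
    exact congrArg (fun f : twistFun G γ => f.1 g) hx
  have hfinrank : Module.finrank F E = Module.finrank F (twistFun G γ) := by
    rw [E.finrank_eq, finrank_twistFun γ hγ, Nat.card_eq_fintype_card]
  refine ⟨γ, hγ, AlgEquiv.ofBijective (orbitHom E φ γ hφ) ⟨hinj,
    (LinearMap.injective_iff_surjective_of_finrank_eq_finrank hfinrank
      (f := (orbitHom E φ γ hφ).toLinearMap)).1 hinj⟩, fun g x h => ?_⟩
  change φ (h • g • x) = φ ((h * g) • x)
  rw [mul_smul]

/-- `Map_G(Y, E)` for the Galois algebra `E` attached to `γ` is the form of `F^Y` twisted by `γ`. -/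
def assocAlgebraTwistEquiv (Y : Type v) [MulAction G Y] (γ : Gal(L/F) →* G)
    (hγ : ∀ᶠ σ in 𝓝 1, γ σ = 1) :
    assocAlgebra Y (galoisAlgebraOfHom γ hγ) ≃ₐ[F] twistFun Y γ where
  toFun φ := ⟨fun y => (show twistFun G γ from φ.1 y).1 1, fun σ y => by
    have hφ : φ.1 (γ σ • y) = γ σ • φ.1 y := φ.2 (γ σ) y
    have hσ := (show twistFun G γ from φ.1 y).2 σ 1
    rw [smul_eq_mul, mul_one] at hσ
    exact (congrArg (fun f : twistFun G γ => f.1 1) hφ).trans ((twistFun_smul_one γ _ _).trans hσ)⟩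
  invFun φ := ⟨fun y => (⟨fun h => φ.1 (h • y), fun σ h => by
      beta_reduce
      rw [← φ.2 σ (h • y), smul_eq_mul, mul_smul]⟩ : twistFun G γ), fun g y =>
    Subtype.ext (funext fun h => congrArg φ.1 (mul_smul h g y).symm)⟩
  left_inv φ := by
    refine Subtype.ext (funext fun y => Subtype.ext (funext fun h => ?_))
    have hφ : φ.1 (h • y) = h • φ.1 y := φ.2 h y
    exact (congrArg (fun f : twistFun G γ => f.1 1) hφ).trans (twistFun_smul_one γ _ _)
  right_inv φ := Subtype.ext (funext fun y => congrArg φ.1 (one_smul G y))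
  map_mul' φ ψ := rfl
  map_add' φ ψ := rfl
  commutes' r := rfl

end GaloisAlgebraOfHom

/-! ### Points of the torus -/

section Lattice

open Multiplicative

variable {X : Type v} {m : ℕ} {G : Type w} [Group G] [MulAction G X]

theorem augMod_eq_degree (f : X →₀ ℤ) : augMod X m f = ((Finsupp.degree f : ℤ) : ZMod m) := by
  have h : augMod X m = (Int.castAddHom (ZMod m)).comp Finsupp.degree := by
    ext x
    simp [augMod]
  rw [h]
  rfl

namespace J

theorem dvd_degree (j : J X m) : (m : ℤ) ∣ Finsupp.degree (j : X →₀ ℤ) := by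
  have h : augMod X m (j : X →₀ ℤ) = 0 := j.2
  rwa [augMod_eq_degree, ZMod.intCast_zmod_eq_zero_iff_dvd] at h

theorem act_diff (g : G) (x y : X) : J.act m g (J.diff X m x y) = J.diff X m (g • x) (g • y) := by
  ext1
  rw [J.coe_act]
  simp only [J.diff]
  rw [sub_eq_add_neg, Finsupp.mapDomain_add, Finsupp.mapDomain_single, ← Finsupp.single_neg,
    Finsupp.mapDomain_single, Finsupp.single_neg, sub_eq_add_neg]

/-- The element `m x` of `J`. -/
def mulSingle (m : ℕ) (x : X) : J X m :=
  ⟨Finsupp.single x m, by rw [J, AddMonoidHom.mem_ker, augMod_eq_degree]; simp⟩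

theorem act_mulSingle (g : G) (x : X) :
    J.act m g (J.mulSingle m x) = J.mulSingle m (g • x) := by
  ext1
  rw [J.coe_act]
  exact Finsupp.mapDomain_single

theorem mulSingle_eq (x y : X) : J.mulSingle m x = m • J.diff X m x y + J.mulSingle m y := by
  ext1
  simp [J.mulSingle, J.diff, smul_sub]

theorem exists_eq_sum (z : X) (j : J X m) : ∃ k : ℤ,
    j = ∑ x ∈ (j : X →₀ ℤ).support, (j : X →₀ ℤ) x • J.diff X m x z + k • J.mulSingle m z := by
  obtain ⟨k, hk⟩ := J.dvd_degree j
  refine ⟨k, Subtype.ext ?_⟩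
  rw [AddSubgroup.coe_add, AddSubgroup.val_finsetSum]
  simp only [J.diff, J.mulSingle, AddSubgroup.coe_zsmul, smul_sub, Finsupp.smul_single, smul_eq_mul,
    mul_one, Finset.sum_sub_distrib]
  rw [mul_comm k, ← hk, ← Finsupp.single_finsetSum, Finsupp.degree_apply, sub_add_cancel]
  exact (Finsupp.sum_single _).symm

theorem hom_ext {M : Type*} [CommGroup M] {t t' : Multiplicative (J X m) →* M} (z : X)
    (hdiff : ∀ x, t (ofAdd (J.diff X m x z)) = t' (ofAdd (J.diff X m x z)))
    (hmul : t (ofAdd (J.mulSingle m z)) = t' (ofAdd (J.mulSingle m z))) : t = t' := by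
  refine MonoidHom.ext fun j => ?_
  obtain ⟨k, hk⟩ := J.exists_eq_sum z j.toAdd
  rw [← ofAdd_toAdd j, hk]
  simp only [ofAdd_add, ofAdd_sum, ofAdd_zsmul, map_mul, map_prod, map_zpow, hdiff, hmul]

end J

variable [Fintype X] {R : Type u} [CommRing R]

/-- The point of the torus given by an invertible function on `X`, through the surjection
`𝔾_m^X → T` with kernel `μ_m` dual to the inclusion `J ⊆ ℤ[X]`. -/
def torusOfFun (m : ℕ) : (X → Rˣ) →* TorusPoints X m R where
  toFun D :=
    { toFun := fun j => ∏ x, D x ^ (j.toAdd : X →₀ ℤ) x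
      map_one' := by simp
      map_mul' := fun i j => by simp [zpow_add, Finset.prod_mul_distrib] }
  map_one' := MonoidHom.ext fun j => by simp
  map_mul' D D' := MonoidHom.ext fun j => by simp [mul_zpow, Finset.prod_mul_distrib]

theorem torusOfFun_apply (D : X → Rˣ) (j : J X m) :
    torusOfFun m D (ofAdd j) = ∏ x, D x ^ (j : X →₀ ℤ) x := rfl

theorem torusOfFun_diff (D : X → Rˣ) (x y : X) :
    torusOfFun m D (ofAdd (J.diff X m x y)) = D x / D y := by
  classical
  simp only [torusOfFun_apply, J.diff, Finsupp.sub_apply, Finsupp.single_apply, zpow_sub,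
    Finset.prod_mul_distrib, Finset.prod_inv_distrib, div_eq_mul_inv]
  simp

theorem torusOfFun_mulSingle (D : X → Rˣ) (x : X) :
    torusOfFun m D (ofAdd (J.mulSingle m x)) = D x ^ m := by
  classical
  simp [torusOfFun_apply, J.mulSingle, Finsupp.single_apply]

theorem torusOfFun_const {a : Rˣ} (ha : a ^ m = 1) : torusOfFun (X := X) m (fun _ => a) = 1 := by
  rcases isEmpty_or_nonempty X with _ | ⟨⟨z⟩⟩
  · exact MonoidHom.ext fun j => by simp [torusOfFun]
  · refine J.hom_ext z (fun x => ?_) ?_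
    · rw [torusOfFun_diff, div_self', MonoidHom.one_apply]
    · rw [torusOfFun_mulSingle, ha, MonoidHom.one_apply]

theorem torusAct_torusOfFun (g : G) (D : X → Rˣ) :
    torusAct X m G R g (torusOfFun m D) = torusOfFun m fun x => D (g⁻¹ • x) := by
  refine MonoidHom.ext fun j => ?_
  refine (Fintype.prod_equiv (MulAction.toPerm g⁻¹) _ _ fun x => ?_).symm
  change _ = D (g⁻¹ • x) ^ Finsupp.mapDomain (g⁻¹ • ·) (j.toAdd : X →₀ ℤ) (g⁻¹ • x)
  rw [Finsupp.mapDomain_apply (MulAction.injective g⁻¹)]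

theorem map_comp_torusOfFun {R' : Type*} [CommRing R'] (φ : R →* R') (D : X → Rˣ) :
    (Units.map φ).comp (torusOfFun m D) = torusOfFun m fun x => Units.map φ (D x) :=
  MonoidHom.ext fun j => by simp [torusOfFun]

end Lattice

/-! ### The factor set of a cocycle -/

section Monomial

variable {R G Y : Type*} [CommRing R] [Group G] [MulAction G Y] [Fintype Y] [DecidableEq Y]

/-- The product of the diagonal matrix of `w` and the permutation matrix of `g`. -/
def monomialMatrix (w : Y → Rˣ) (g : G) : GL Y R where
  val := .of fun x y => if g⁻¹ • x = y then (w x : R) else 0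
  inv := .of fun x y => if g⁻¹ • y = x then ((w y)⁻¹ : Rˣ) else 0
  val_inv := by
    ext x y
    suffices (if x = y then (w x * (w y)⁻¹ : R) else 0) = if x = y then 1 else 0 by
      simpa [Matrix.mul_apply, Matrix.one_apply, eq_comm]
    split_ifs with hxy
    · rw [hxy, Units.mul_inv]
    · rfl
  inv_val := by
    ext x y
    simp [Matrix.mul_apply, Matrix.one_apply, inv_smul_eq_iff, eq_comm (b := y)]

theorem monomialMatrix_mul_apply (w : Y → Rˣ) (g : G) (M : Matrix Y Y R) (x y : Y) :
    ((monomialMatrix w g).1 * M) x y = w x * M (g⁻¹ • x) y := by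
  simp [monomialMatrix, Matrix.mul_apply]

theorem mul_monomialMatrix_apply (w : Y → Rˣ) (g : G) (M : Matrix Y Y R) (x y : Y) :
    (M * (monomialMatrix w g).1) x y = M x (g • y) * w (g • y) := by
  simp [monomialMatrix, Matrix.mul_apply, inv_smul_eq_iff]

theorem monomialMatrix_one : monomialMatrix (1 : Y → Rˣ) (1 : G) = 1 := by
  ext x y
  simp [monomialMatrix, Matrix.one_apply]

end Monomial

section AdMatrix

open Multiplicative

variable {F : Type u} [Field F] {G : Type w} [Group G] {X : Type v} [MulAction G X] {m : ℕ}

section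

variable {R : Type u} [CommRing R]

theorem torusAct_apply (g : G) (t : TorusPoints X m R) (j : J X m) :
    torusAct X m G R g t (ofAdd j) = t (ofAdd (J.act m g⁻¹ j)) := rfl

theorem adMatrix_apply (p : TorusSemidirect X m G R) (M : Matrix X X R) (x y : X) :
    adMatrix p M x y = (p.left (ofAdd (J.diff X m x y)) : R) *
      M (p.right⁻¹ • x) (p.right⁻¹ • y) := rfl

theorem adMatrix_mul (p q : TorusSemidirect X m G R) (M : Matrix X X R) :
    adMatrix (p * q) M = adMatrix p (adMatrix q M) := by
  ext x y
  simp only [adMatrix_apply, SemidirectProduct.mul_left, SemidirectProduct.mul_right,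
    MonoidHom.mul_apply, torusAct_apply, J.act_diff, Units.val_mul, mul_inv_rev, mul_smul,
    mul_assoc]

theorem adMatrix_one (M : Matrix X X R) : adMatrix (1 : TorusSemidirect X m G R) M = M := by
  ext x y
  simp [adMatrix_apply]

theorem adMatrix_injective (p : TorusSemidirect X m G R) :
    Function.Injective (adMatrix p) :=
  Function.LeftInverse.injective (g := adMatrix p⁻¹) fun M => by
    rw [← adMatrix_mul, inv_mul_cancel, adMatrix_one]

theorem map_adMatrix (σ : AbsGal F) (p : TorusSemidirect X m G (SeparableClosure F))
    (M : Matrix X X (SeparableClosure F)) :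
    (adMatrix p M).map σ = adMatrix (σ • p) (M.map σ) := by
  ext x y
  simp [adMatrix_apply, smul_left, smul_right]

theorem adMatrix_mul_monomialMatrix [Fintype X] [DecidableEq X] (p : TorusSemidirect X m G R)
    (M : Matrix X X R) (z : X) :
    adMatrix p M * (monomialMatrix (fun x => p.left (ofAdd (J.diff X m x z))) p.right).1 =
      (monomialMatrix (fun x => p.left (ofAdd (J.diff X m x z))) p.right).1 * M := by
  ext x y
  rw [mul_monomialMatrix_apply, monomialMatrix_mul_apply, adMatrix_apply, inv_smul_smul,
    ← J.diff_add m x (p.right • y) z, ofAdd_add, map_mul, Units.val_mul]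
  ring

end

namespace Cocycle

open Topology

instance : SMul (AbsGal F) (SeparableClosure F)ˣ :=
  AlgEquiv.instMulDistribMulActionUnits.toSMul

variable (c : Cocycle (AbsGal F) (TorusSemidirect X m G (SeparableClosure F)))

theorem map_one : c 1 = 1 := by
  have h := c.map_mul' 1 1
  rw [mul_one, one_smul] at h
  exact left_eq_mul.1 h

theorem eventually_eq_one : ∀ᶠ σ in 𝓝 1, c σ = 1 := by
  have h := (IsLocallyConstant.iff_eventually_eq _).1 c.locConst 1
  rwa [c.map_one] at h

/-- The image of a cocycle in `Hom(Gal(F_sep/F), G)`. -/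
def rightHom : AbsGal F →* G where
  toFun σ := (c σ).right
  map_one' := by rw [c.map_one, SemidirectProduct.one_right]
  map_mul' σ τ := by rw [c.map_mul', SemidirectProduct.mul_right, smul_right]

theorem eventually_rightHom : ∀ᶠ σ in 𝓝 1, c.rightHom σ = 1 :=
  c.eventually_eq_one.mono fun _ h => congrArg SemidirectProduct.right h

/-- The value `t_σ(j)` of a cocycle `c = (t_σ, γ_σ)_σ` at a character `j` of the torus. -/
def eval (σ : AbsGal F) (j : J X m) : (SeparableClosure F)ˣ := (c σ).left (ofAdd j)

theorem eventually_eval_eq_one : ∀ᶠ σ in 𝓝 1, c.eval σ = 1 :=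
  c.eventually_eq_one.mono fun σ h => funext fun j => by
    rw [eval, h, SemidirectProduct.one_left, MonoidHom.one_apply, Pi.one_apply]

theorem eval_add (σ : AbsGal F) (i j : J X m) : c.eval σ (i + j) = c.eval σ i * c.eval σ j :=
  map_mul (c σ).left _ _

theorem eval_nsmul (σ : AbsGal F) (n : ℕ) (j : J X m) : c.eval σ (n • j) = c.eval σ j ^ n :=
  map_pow (c σ).left _ _

theorem eval_diff_self (σ : AbsGal F) (z : X) : c.eval σ (J.diff X m z z) = 1 := by
  rw [J.diff_self]
  exact _root_.map_one (c σ).left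

theorem eval_mul (σ τ : AbsGal F) (j : J X m) :
    c.eval (σ * τ) j = c.eval σ j * σ • c.eval τ (J.act m (c.rightHom σ)⁻¹ j) := by
  rw [eval, c.map_mul']
  rfl

/-- The factor set of a cocycle relative to the lifts of `t_σ` to `𝔾_m^X` with value `1` at `z`. -/
def factor (z : X) (σ τ : AbsGal F) : (SeparableClosure F)ˣ :=
  σ • c.eval τ (J.diff X m ((c.rightHom σ)⁻¹ • z) z)

theorem hasCoboundary (z : X) :
    HasCoboundary c.rightHom (fun σ x => c.eval σ (J.diff X m x z)) (c.factor z) where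
  eventually_eq_one := c.eventually_eval_eq_one.mono fun σ h => funext fun x => by
    rw [h, Pi.one_apply, Pi.one_apply]
  mul_smul σ τ x := by
    rw [eval_mul, J.act_diff, factor, mul_left_comm, ← smul_mul', ← eval_add, add_comm, J.diff_add]

theorem eval_mulSingle_mul (z : X) (σ τ : AbsGal F) :
    c.eval σ (J.mulSingle m z) * σ • c.eval τ (J.mulSingle m z) * c.factor z σ τ ^ m =
      c.eval (σ * τ) (J.mulSingle m z) := by
  rw [eval_mul, J.act_mulSingle, J.mulSingle_eq ((c.rightHom σ)⁻¹ • z) z,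
    eval_add, eval_nsmul, smul_mul', smul_pow',
    mul_comm (_ ^ m), mul_assoc]
  rfl

variable [Fintype X] [DecidableEq X]

/-- The Galois action on `M_X(F_sep)` twisted by a cocycle. -/
def matrixAction : SemilinearAction F (SeparableClosure F) (Matrix X X (SeparableClosure F)) where
  toFun σ :=
    { toFun := fun M => adMatrix (c σ) (M.map σ)
      map_zero' := by refine Matrix.ext fun x y => ?_; simp [adMatrix_apply]
      map_add' := fun M N => by refine Matrix.ext fun x y => ?_; simp [adMatrix_apply, mul_add] }
  map_smul' σ a M := by
    refine Matrix.ext fun x y => ?_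
    change _ * σ (a * _) = σ a * (_ * σ _)
    rw [map_mul, mul_left_comm]
  map_mul' σ τ M := by
    change adMatrix (c (σ * τ)) _ = adMatrix (c σ) ((adMatrix (c τ) (M.map τ)).map σ)
    rw [c.map_mul', adMatrix_mul, map_adMatrix]
    rfl
  eventually_fixed M := by
    filter_upwards [c.eventually_eq_one, eventually_map_eq M] with σ h h'
    change adMatrix (c σ) (M.map σ) = M
    rw [h, h', adMatrix_one]

instance finite_twistMatrix : Module.Finite F (twistMatrix c) :=
  (isForm_val_of_invariants c.matrixAction (twistMatrix c) fun _ => Iff.rfl).1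

theorem isForm_twistMatrix : IsForm (SeparableClosure F) (twistMatrix c).val :=
  (isForm_val_of_invariants c.matrixAction (twistMatrix c) fun _ => Iff.rfl).2

/-- The lift to `GL_X(F_sep)` of the image of a cocycle in `PGL_X(F_sep)`. -/
def galoisLift (z : X) : GaloisLift (twistMatrix c).val where
  toFun σ := monomialMatrix (fun x => c.eval σ (J.diff X m x z)) (c.rightHom σ)
  factor := c.factor z
  mul_map' σ τ := by
    refine Matrix.ext fun x y => ?_
    have h := congrArg Units.val ((c.hasCoboundary z).mul_smul σ τ x)
    rw [monomialMatrix_mul_apply, Matrix.smul_apply]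
    simp only [monomialMatrix, Matrix.map_apply, Matrix.of_apply, map_mul, mul_inv_rev, mul_smul,
      apply_ite σ, map_zero, mul_ite, mul_zero, smul_ite, smul_zero]
    exact if_congr Iff.rfl h rfl
  eventually_eq_one := by
    filter_upwards [(c.hasCoboundary z).eventually_eq_one, c.eventually_rightHom] with σ h h'
    rw [h, h', monomialMatrix_one]
  mul_map_apply' σ s :=
    (adMatrix_mul_monomialMatrix (c σ) (s.1.map σ) z).symm.trans (congrArg (· * _) (s.2 σ))

variable [Nonempty X] {S : Type*} [Ring S] [Algebra F S] (e : S ≃ₐ[F] twistMatrix c)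

include e

theorem isSplit_twistFun : IsSplit (twistFun X c.rightHom) (twistFun X c.rightHom ⊗[F] S) := by
  obtain ⟨z⟩ := ‹Nonempty X›
  have : Module.Finite F S := Module.Finite.equiv e.symm.toLinearEquiv
  obtain ⟨θ, hθ⟩ := HasCoboundary.exists_isEquivariantFamily ((c.galoisLift z).comp e.toAlgHom)
    c.eventually_rightHom (c.isForm_twistMatrix.comp_algEquiv_left e) (c.hasCoboundary z)
  exact hθ.isSplit c.eventually_rightHom AlgEquiv.refl

theorem isSplit_piTensorProduct : IsSplit F (⨂[F] _ : Fin m, S) := by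
  obtain ⟨z⟩ := ‹Nonempty X›
  have : Module.Finite F S := Module.Finite.equiv e.symm.toLinearEquiv
  exact ((c.galoisLift z).comp e.toAlgHom).isSplit_piTensorProduct
    (c.isForm_twistMatrix.comp_algEquiv_left e) (fun σ => c.eval σ (J.mulSingle m z))
    (c.eventually_eval_eq_one.mono fun σ h => congrFun h _) (c.eval_mulSingle_mul z)

end Cocycle

end AdMatrix

section FactorSets

open Topology

variable {F L : Type*} [Field F] [Field L] [Algebra F L]

theorem GaloisLift.exists_factor_eq_of_matrix_equiv [Algebra.IsIntegral F L] {S S' ι κ : Type*}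
    [Ring S] [Algebra F S] [Module.Finite F S] [Ring S'] [Algebra F S'] [Module.Finite F S']
    [Fintype ι] [DecidableEq ι] [Nonempty ι] [Fintype κ] [DecidableEq κ]
    {f : S →ₐ[F] Matrix ι ι L} {g : S' →ₐ[F] Matrix κ κ L}
    (p : GaloisLift f) (q : GaloisLift g) (hf : IsForm L f) (hg : IsForm L g) {k l : ℕ} (hk : k ≠ 0)
    (i : Matrix (Fin k) (Fin k) S ≃ₐ[F] Matrix (Fin l) (Fin l) S') :
    ∃ e : Gal(L/F) → Lˣ, (∀ᶠ σ in 𝓝 1, e σ = 1) ∧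
      ∀ σ τ, e σ * σ • e τ * q.factor σ τ = p.factor σ τ * e (σ * τ) := by
  have : NeZero k := ⟨hk⟩
  let j := ((matrixEquivTensor (Fin k) F S).symm.trans i).trans (matrixEquivTensor (Fin l) F S')
  let p' := p.kronecker (.ofAlgEquiv (.refl (A₁ := Matrix (Fin k) (Fin k) F)))
  let q' := (q.kronecker (.ofAlgEquiv (.refl (A₁ := Matrix (Fin l) (Fin l) F)))).comp j.toAlgHom
  obtain ⟨e, he, h⟩ := p'.exists_factor_eq q' (hf.kroneckerHom isForm_ofId.mapMatrix)
    ((hg.kroneckerHom isForm_ofId.mapMatrix).comp_algEquiv_left j)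
  refine ⟨e, he, fun σ τ => ?_⟩
  have hp : p'.factor σ τ = p.factor σ τ := mul_one _
  have hq : q'.factor σ τ = q.factor σ τ := mul_one _
  rw [← hp, ← hq, h]

theorem exists_pow_mul_eq [IsGalois F L] [IsSepClosed L] {m : ℕ} (hm : (m : L) ≠ 0)
    {a a' : Gal(L/F) → Gal(L/F) → Lˣ} {t t' e : Gal(L/F) → Lˣ}
    (ht : ∀ σ τ, t σ * σ • t τ * a σ τ ^ m = t (σ * τ))
    (ht' : ∀ σ τ, t' σ * σ • t' τ * a' σ τ ^ m = t' (σ * τ))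
    (he : ∀ σ τ, e σ * σ • e τ * a σ τ = a' σ τ * e (σ * τ))
    (ht1 : ∀ᶠ σ in 𝓝 1, t σ = 1) (ht1' : ∀ᶠ σ in 𝓝 1, t' σ = 1) (he1 : ∀ᶠ σ in 𝓝 1, e σ = 1) :
    ∃ e' : Gal(L/F) → Lˣ, (∀ᶠ σ in 𝓝 1, e' σ = 1) ∧
      (∀ σ τ, e' σ * σ • e' τ * a σ τ = a' σ τ * e' (σ * τ)) ∧ ∀ σ, e' σ ^ m * t' σ = t σ := by
  have hmul (σ τ : Gal(L/F)) : t' σ * e σ ^ m * σ • (t' τ * e τ ^ m) * a σ τ ^ m =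
      t' (σ * τ) * e (σ * τ) ^ m := by
    rw [smul_mul', mul_mul_mul_comm, mul_assoc, smul_pow', ← mul_pow, ← mul_pow, he, mul_pow,
      ← mul_assoc, ht']
  obtain ⟨d, hd⟩ := exists_eq_smul_div (fun σ => t σ / (t' σ * e σ ^ m))
    (fun σ τ => by rw [← ht, ← hmul, mul_div_mul_right_eq_div, smul_div', div_mul_div_comm])
    (by
      filter_upwards [ht1, ht1', he1] with σ h h' h''
      rw [h, h', h'', one_pow, mul_one, div_one])
  obtain ⟨s, rfl⟩ := exists_units_pow_eq hm d
  refine ⟨fun σ => e σ * (s / σ • s), ?_, fun σ τ => ?_, fun σ => ?_⟩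
  · filter_upwards [he1, eventually_apply_eq (s : L)] with σ h h'
    rw [h, one_mul, div_eq_one]
    exact (Units.ext h').symm
  · rw [smul_mul', smul_div', smul_smul, mul_mul_mul_comm, div_mul_div_cancel, mul_right_comm, he,
      mul_assoc]
  · have h := hd σ
    rw [div_mul_eq_mul_div, div_eq_iff_eq_mul] at h
    rw [mul_pow, div_pow, ← smul_pow', ← mul_div_assoc, div_mul_eq_mul_div, div_eq_iff_eq_mul, h,
      mul_comm (e σ ^ m), mul_assoc, mul_comm (t' σ)]

end FactorSets

section Cocycle

open Topology Multiplicative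

variable {F : Type u} [Field F] {G : Type w} [Group G] {X : Type v} [MulAction G X] {m : ℕ}

namespace Cocycle

variable (c c' : Cocycle (AbsGal F) (TorusSemidirect X m G (SeparableClosure F)))

theorem left_eq_torusOfFun_mul_left [Fintype X] (z : X) {e : AbsGal F → (SeparableClosure F)ˣ}
    (he : ∀ σ, e σ ^ m * c'.eval σ (J.mulSingle m z) = c.eval σ (J.mulSingle m z)) (σ : AbsGal F) :
    (c σ).left = torusOfFun m (fun x =>
      e σ * (c.eval σ (J.diff X m x z) / c'.eval σ (J.diff X m x z))) * (c' σ).left := by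
  refine J.hom_ext z (fun x => ?_) ?_
  · rw [MonoidHom.mul_apply, torusOfFun_diff, eval_diff_self, eval_diff_self, div_one, mul_one,
      mul_div_cancel_left]
    exact (div_mul_cancel _ _).symm
  · rw [MonoidHom.mul_apply, torusOfFun_mulSingle, eval_diff_self, eval_diff_self, div_one, mul_one]
    exact (he σ).symm

theorem cohomologous_of_factor_eq [Finite X] (hm : (m : SeparableClosure F) ≠ 0) (z : X)
    (hγ : c.rightHom = c'.rightHom) {e : AbsGal F → (SeparableClosure F)ˣ}
    (he : ∀ᶠ σ in 𝓝 1, e σ = 1)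
    (h : ∀ σ τ, e σ * σ • e τ * c.factor z σ τ = c'.factor z σ τ * e (σ * τ)) :
    cohomologous _ _ c c' := by
  cases nonempty_fintype X
  obtain ⟨e', he', h', hpow⟩ := exists_pow_mul_eq hm (c.eval_mulSingle_mul z)
    (c'.eval_mulSingle_mul z) h (c.eventually_eval_eq_one.mono fun σ h => congrFun h _)
    (c'.eventually_eval_eq_one.mono fun σ h => congrFun h _) he
  let w (σ : AbsGal F) (x : X) : (SeparableClosure F)ˣ :=
    e' σ * (c.eval σ (J.diff X m x z) / c'.eval σ (J.diff X m x z))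
  obtain ⟨D, hD⟩ := exists_invariant_unit c.rightHom c.eventually_rightHom w
    (fun σ τ x => by
      have hc := (c.hasCoboundary z).mul_smul σ τ x
      have hc' := (c'.hasCoboundary z).mul_smul σ τ x
      rw [← hγ] at hc'
      simp only [w]
      rw [smul_mul', smul_div', mul_mul_mul_comm, div_mul_div_comm, hc, hc', mul_div_mul_comm,
        ← mul_assoc, ← mul_div_assoc (e' σ * _), h', mul_div_cancel_left])
    (by
      filter_upwards [he', c.eventually_eval_eq_one, c'.eventually_eval_eq_one] with σ h h' h''
      funext x
      simp only [w, h, h', h'', Pi.one_apply, div_one, mul_one])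
  refine ⟨SemidirectProduct.inl (torusOfFun m D), fun σ => ?_⟩
  rw [mul_assoc, eq_inv_mul_iff_mul_eq]
  refine SemidirectProduct.ext ?_ ?_
  · rw [SemidirectProduct.mul_left, SemidirectProduct.mul_left, smul_left,
      SemidirectProduct.left_inl, SemidirectProduct.right_inl, _root_.map_one, MulAut.one_apply,
      map_comp_torusOfFun, torusAct_torusOfFun, c.left_eq_torusOfFun_mul_left c' z hpow,
      mul_right_comm (G := TorusPoints X m (SeparableClosure F)), ← map_mul]
    exact congrArg (torusOfFun m · * _) (funext fun x => (hD σ x).symm)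
  · rw [SemidirectProduct.mul_right, SemidirectProduct.mul_right, smul_right,
      SemidirectProduct.right_inl, one_mul, mul_one]
    exact (DFunLike.congr_fun hγ σ).symm

end Cocycle

end Cocycle

section Surjective

open Topology Multiplicative

theorem isLocallyConstant_of_eventually_eq_one {Γ A : Type*} [Group Γ] [TopologicalSpace Γ]
    [SeparatelyContinuousMul Γ] [Group A] [MulDistribMulAction Γ A] (c : Γ → A)
    (hmul : ∀ σ τ, c (σ * τ) = c σ * σ • c τ) (hc : ∀ᶠ σ in 𝓝 1, c σ = 1) :
    IsLocallyConstant c := by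
  rw [IsLocallyConstant.iff_eventually_eq]
  intro σ
  have hσ : Filter.Tendsto (fun τ => σ⁻¹ * τ) (𝓝 σ) (𝓝 1) := by
    simpa only [inv_mul_cancel] using (continuous_const_mul σ⁻¹).tendsto σ
  filter_upwards [hσ.eventually hc] with τ h
  rw [← mul_inv_cancel_left σ τ, hmul, h, smul_one, mul_one]

variable {F : Type u} [Field F] {G : Type w} [Group G] {X : Type v} [MulAction G X] {m : ℕ}

namespace Cocycle

section OfHasCoboundary

variable [Fintype X] {γ : AbsGal F →* G} {u : AbsGal F → X → (SeparableClosure F)ˣ}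
  {a : AbsGal F → AbsGal F → (SeparableClosure F)ˣ}

/-- The cocycle attached to functions `u_σ` on `X` whose failure to be a cocycle is a family of
`m`-th roots of unity. -/
def ofHasCoboundary (hγ : ∀ᶠ σ in 𝓝 1, γ σ = 1) (hu : HasCoboundary γ u a) (ha : a ^ m = 1) :
    Cocycle (AbsGal F) (TorusSemidirect X m G (SeparableClosure F)) :=
  have hmul (σ τ : AbsGal F) : (⟨torusOfFun m (u (σ * τ)), γ (σ * τ)⟩ :
      TorusSemidirect X m G (SeparableClosure F)) =
      ⟨torusOfFun m (u σ), γ σ⟩ * σ • ⟨torusOfFun m (u τ), γ τ⟩ := by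
    refine SemidirectProduct.ext ?_ (map_mul γ σ τ)
    have hfun : (u σ * fun x => σ • u τ ((γ σ)⁻¹ • x)) = (fun _ => a σ τ) * u (σ * τ) :=
      funext (hu.mul_smul σ τ)
    have hconst : torusOfFun m (u (σ * τ)) = torusOfFun m ((fun _ => a σ τ) * u (σ * τ)) := by
      rw [map_mul, torusOfFun_const (congrFun₂ ha σ τ)]
      exact (one_mul (torusOfFun m (u (σ * τ)))).symm
    rw [SemidirectProduct.mul_left, smul_left, map_comp_torusOfFun, torusAct_torusOfFun,
      ← map_mul]
    exact hconst.trans (congrArg _ hfun.symm)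
  { toFun σ := ⟨torusOfFun m (u σ), γ σ⟩
    map_mul' := hmul
    locConst := isLocallyConstant_of_eventually_eq_one _ hmul <| by
      filter_upwards [hγ, hu.eventually_eq_one] with σ h h'
      rw [h, h', _root_.map_one]
      rfl }

variable [DecidableEq X]

theorem exists_galoisLift_ofHasCoboundary (hγ : ∀ᶠ σ in 𝓝 1, γ σ = 1) (hu : HasCoboundary γ u a)
    (ha : a ^ m = 1) (z : X) :
    ∃ p : GaloisLift (twistMatrix (ofHasCoboundary hγ hu ha)).val, p.factor = a := by
  refine ⟨((ofHasCoboundary hγ hu ha).galoisLift z).rescale (fun σ => u σ z)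
    (hu.eventually_eq_one.mono fun σ h => congrFun h z), funext₂ fun σ τ => ?_⟩
  change u σ z * σ • u τ z * (u (σ * τ) z)⁻¹ *
    σ • torusOfFun m (u τ) (ofAdd (J.diff X m ((γ σ)⁻¹ • z) z)) = a σ τ
  rw [torusOfFun_diff, mul_right_comm, mul_assoc (u σ z), ← smul_mul', mul_div_cancel,
    hu.mul_smul, mul_inv_cancel_right]

end OfHasCoboundary

variable [Fintype X] [DecidableEq X] [Nonempty X]

theorem exists_twistMatrix_equiv (hm : (m : SeparableClosure F) ≠ 0) {γ : AbsGal F →* G}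
    (hγ : ∀ᶠ σ in 𝓝 1, γ σ = 1) {S : Type*} [Ring S] [Algebra F S] [Module.Finite F S]
    (hS : IsSplit F (⨂[F] _ : Fin m, S))
    (hS' : IsSplit (twistFun X γ) (twistFun X γ ⊗[F] S)) :
    ∃ c : Cocycle (AbsGal F) (TorusSemidirect X m G (SeparableClosure F)), c.rightHom = γ ∧
      ∃ k l : ℕ, k ≠ 0 ∧ l ≠ 0 ∧
        Nonempty (Matrix (Fin k) (Fin k) S ≃ₐ[F] Matrix (Fin l) (Fin l) (twistMatrix c)) := by
  obtain ⟨z⟩ := ‹Nonempty X›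
  obtain ⟨d, hd, θ, hθ⟩ := exists_isEquivariantFamily hγ hS'
  have : NeZero d := ⟨hd⟩
  obtain ⟨p, u, hu⟩ := hθ.exists_hasCoboundary hγ z
  obtain ⟨e, he, hpow⟩ := p.exists_rescale_factor_pow_eq_one hm (hθ.isForm z) hS
  obtain ⟨q, hq⟩ := exists_galoisLift_ofHasCoboundary hγ (hu.rescale p e he) hpow z
  exact ⟨ofHasCoboundary hγ (hu.rescale p e he) hpow, rfl,
    (p.rescale e he).exists_matrix_equiv q (hθ.isForm z) (isForm_twistMatrix _) hq.symm⟩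

end Cocycle

end Surjective

/-! ### The classification -/

section Classification

open Topology

/-- An isomorphism of algebras restricts to subalgebras which correspond to each other. -/
def subalgebraCongr {F A B : Type*} [CommSemiring F] [Semiring A] [Semiring B] [Algebra F A]
    [Algebra F B] (e : A ≃ₐ[F] B) {S : Subalgebra F A} {T : Subalgebra F B}
    (h : ∀ a, e a ∈ T ↔ a ∈ S) : S ≃ₐ[F] T :=
  (e.subalgebraMap S).trans <| Subalgebra.equivOfEq _ _ <| by
    rw [show S = T.comap e from Subalgebra.ext fun a => (h a).symm]
    exact Subalgebra.map_comap_eq_self_of_surjective e.surjective T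

/-- The automorphism of `M_X(R)` given by a point of `T ⋊ G`. -/
def adMatrixEquiv {G : Type w} [Group G] {X : Type v} [MulAction G X] {m : ℕ} [Fintype X]
    [DecidableEq X] {R : Type u} [CommRing R] (p : TorusSemidirect X m G R) :
    Matrix X X R ≃ₐ[R] Matrix X X R where
  toFun := adMatrix p
  invFun := adMatrix p⁻¹
  left_inv M := by rw [← adMatrix_mul, inv_mul_cancel, adMatrix_one]
  right_inv M := by rw [← adMatrix_mul, mul_inv_cancel, adMatrix_one]
  map_add' M N := by
    ext x y
    simp only [adMatrix_apply, Matrix.add_apply, mul_add]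
  map_mul' M N := by
    ext x y
    simp only [adMatrix_apply, Matrix.mul_apply, Finset.mul_sum]
    refine Fintype.sum_equiv (MulAction.toPerm p.right) _ _ fun z => ?_
    rw [MulAction.toPerm_apply, inv_smul_smul, ← J.diff_add m x (p.right • z) y, ofAdd_add,
      map_mul, Units.val_mul, mul_mul_mul_comm]
  commutes' r := by
    ext x y
    rcases eq_or_ne x y with rfl | h
    · simp [adMatrix_apply, Matrix.algebraMap_matrix_apply, J.diff_self]
    · simp [adMatrix_apply, Matrix.algebraMap_matrix_apply, h]

variable {F : Type u} [Field F]

theorem isBrauerEquivalent_of_equiv {A B : CSA.{u, u} F} (e : A ≃ₐ[F] B) :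
    IsBrauerEquivalent A B :=
  ⟨1, 1, one_ne_zero, one_ne_zero, ⟨e.mapMatrix⟩⟩

theorem mk_galoisAlgebraOfHom_eq {G : Type} [Group G] [Finite G] {L : Type u} [Field L]
    [Algebra F L] [IsGalois F L] (γ γ' : Gal(L/F) →* G) (hγ : ∀ᶠ σ in 𝓝 1, γ σ = 1)
    (hγ' : ∀ᶠ σ in 𝓝 1, γ' σ = 1) (g : G) (h : ∀ σ, γ' σ = g⁻¹ * γ σ * g) :
    GaloisClass.mk (galoisAlgebraOfHom γ hγ) = GaloisClass.mk (galoisAlgebraOfHom γ' hγ') := by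
  let e := AlgEquiv.piCongrLeft' F (fun _ : G => L) (Equiv.mulLeft g).symm
  have he (f : G → L) : e f ∈ twistFun G γ' ↔ f ∈ twistFun G γ := by
    have hgb (σ : Gal(L/F)) (b : G) : g * (γ' σ * b) = γ σ * (g * b) := by rw [h]; group
    refine forall_congr' fun σ => (Equiv.mulLeft g).forall_congr fun {b} => ?_
    change f (g * (γ' σ * b)) = σ (f (g * b)) ↔ f (γ σ * (g * b)) = σ (f (g * b))
    rw [hgb]
  exact Quotient.sound ⟨subalgebraCongr e he,
    fun _ x => Subtype.ext (funext fun b => congrArg x.1 (mul_assoc _ _ _))⟩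

variable {G : Type} [Group G] {X : Type v} [MulAction G X] {m : ℕ}

theorem smul_inr (σ : AbsGal F) (g : G) :
    σ • (SemidirectProduct.inr g : TorusSemidirect X m G (SeparableClosure F)) =
      SemidirectProduct.inr g := by
  refine SemidirectProduct.ext ?_ rfl
  rw [smul_left, SemidirectProduct.left_inr]
  exact MonoidHom.comp_one _

namespace Cocycle

/-- Conjugation of a cocycle by an invariant element. -/
def conj {Γ A : Type*} [Group Γ] [TopologicalSpace Γ] [Group A] [MulDistribMulAction Γ A]
    (c : Cocycle Γ A) (a : A) (ha : ∀ σ : Γ, σ • a = a) : Cocycle Γ A where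
  toFun σ := a⁻¹ * c σ * a
  map_mul' σ τ := by rw [c.map_mul', smul_mul', smul_mul', smul_inv', ha]; group
  locConst := c.locConst.comp fun x => a⁻¹ * x * a

variable {c c' : Cocycle (AbsGal F) (TorusSemidirect X m G (SeparableClosure F))}

/-- The isomorphism of the algebras attached to two cohomologous cocycles. -/
def twistMatrixEquiv [Fintype X] [DecidableEq X]
    (a : TorusSemidirect X m G (SeparableClosure F)) (h : ∀ σ, c' σ = a⁻¹ * c σ * σ • a) :
    twistMatrix c ≃ₐ[F] twistMatrix c' :=
  subalgebraCongr ((adMatrixEquiv a⁻¹).restrictScalars F) fun M => forall_congr' fun σ => by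
    change adMatrix (c' σ) ((adMatrix a⁻¹ M).map σ) = adMatrix a⁻¹ M ↔ _
    rw [map_adMatrix, ← adMatrix_mul, h, smul_inv', mul_inv_cancel_right, adMatrix_mul,
      (adMatrix_injective a⁻¹).eq_iff]

section FiniteGroup

variable [Finite G]

variable (c) in
/-- The Galois algebra attached to a cocycle. -/
abbrev galois : GaloisAlgebra G F := galoisAlgebraOfHom c.rightHom c.eventually_rightHom

variable (c) in
theorem relBrauerClass_galois :
    relBrauerClass X m (GaloisClass.mk c.galois) = relBrauer m F (twistFun X c.rightHom) :=
  relBrauer_congr m F (assocAlgebraTwistEquiv X c.rightHom c.eventually_rightHom)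

theorem mk_galois_eq (a : TorusSemidirect X m G (SeparableClosure F))
    (h : ∀ σ, c' σ = a⁻¹ * c σ * σ • a) :
    GaloisClass.mk c.galois = GaloisClass.mk c'.galois :=
  mk_galoisAlgebraOfHom_eq _ _ _ _ a.right fun σ => congrArg SemidirectProduct.right (h σ)

end FiniteGroup

variable [Fintype X] [DecidableEq X] [Nonempty X]

variable (c) in
theorem exists_csa : ∃ A : CSA.{u, u} F, Nonempty (A ≃ₐ[F] twistMatrix c) := by
  have : Small.{u} (twistMatrix c) :=
    ⟨⟨_, ⟨(Module.finBasis F (twistMatrix c)).equivFun.toEquiv⟩⟩⟩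
  let e := Shrink.algEquiv F (twistMatrix c)
  have hform := c.isForm_twistMatrix.comp_algEquiv_left e
  exact ⟨{
    toAlgCat := AlgCat.of F (Shrink.{u} (twistMatrix c))
    isCentral := hform.isCentral
    isSimple := hform.isSimpleRing
    fin_dim := Module.Finite.equiv e.symm.toLinearEquiv }, ⟨e⟩⟩

variable (c) in
/-- The central simple algebra attached to a cocycle. -/
def csa : CSA.{u, u} F := c.exists_csa.choose

variable (c) in
/-- The identification of `csa` with the twisted matrix algebra. -/
def csaEquiv : c.csa ≃ₐ[F] twistMatrix c := c.exists_csa.choose_spec.some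

theorem csa_isBrauerEquivalent (a : TorusSemidirect X m G (SeparableClosure F))
    (h : ∀ σ, c' σ = a⁻¹ * c σ * σ • a) : IsBrauerEquivalent c.csa c'.csa :=
  isBrauerEquivalent_of_equiv ((c.csaEquiv.trans (twistMatrixEquiv a h)).trans c'.csaEquiv.symm)

theorem cohomologous_of_isBrauerEquivalent (hm : (m : SeparableClosure F) ≠ 0)
    (hγ : c.rightHom = c'.rightHom) (h : IsBrauerEquivalent c.csa c'.csa) :
    cohomologous _ _ c c' := by
  obtain ⟨k, l, hk, -, ⟨i⟩⟩ := h.symm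
  obtain ⟨z⟩ := ‹Nonempty X›
  obtain ⟨e, he, hfactor⟩ := (c'.galoisLift z).exists_factor_eq_of_matrix_equiv (c.galoisLift z)
    c'.isForm_twistMatrix c.isForm_twistMatrix hk
    ((c'.csaEquiv.mapMatrix.symm.trans i).trans c.csaEquiv.mapMatrix)
  exact cohomologous_of_factor_eq c c' hm z hγ he hfactor

variable [Finite G]

variable (c) in
theorem csa_mem_relBrauer :
    Quotient.mk (Brauer.CSA_Setoid F) c.csa ∈ relBrauerClass X m (GaloisClass.mk c.galois) := by
  rw [relBrauerClass_galois]
  exact ⟨c.csa, rfl, c.isSplit_piTensorProduct c.csaEquiv, c.isSplit_twistFun c.csaEquiv⟩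

variable (c) in
/-- The Galois algebra and the Brauer class attached to a cocycle. -/
def classify : Σ ε : GaloisClass G F, relBrauerClass X m ε :=
  ⟨GaloisClass.mk c.galois, Quotient.mk (Brauer.CSA_Setoid F) c.csa, c.csa_mem_relBrauer⟩

theorem cohomologous_of_classify_eq (hm : (m : SeparableClosure F) ≠ 0)
    (h : c.classify = c'.classify) : cohomologous _ _ c c' := by
  obtain ⟨e, he⟩ : galoisIso G F c.galois c'.galois := Quotient.exact (congrArg Sigma.fst h)
  obtain ⟨g, hg⟩ := isConj_of_twistFun_equiv c.rightHom c'.rightHom c.eventually_rightHom e he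
  have hA : IsBrauerEquivalent c.csa c'.csa :=
    Quotient.exact (congrArg (fun x => (x.2 : BrauerGroup.{u, u} F)) h)
  let c₁ := c.conj (SemidirectProduct.inr g) fun σ => smul_inr σ g
  have hc₁ (σ : AbsGal F) :
      c₁ σ = (SemidirectProduct.inr g)⁻¹ * c σ * σ • SemidirectProduct.inr g := by
    rw [smul_inr]
    rfl
  have hγ : c₁.rightHom = c'.rightHom := MonoidHom.ext fun σ => (hg σ).symm
  exact (cohomologous _ _).trans ⟨_, hc₁⟩
    (cohomologous_of_isBrauerEquivalent hm hγ ((csa_isBrauerEquivalent _ hc₁).symm.trans hA))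

theorem exists_classify_eq (hm : (m : SeparableClosure F) ≠ 0)
    (p : Σ ε : GaloisClass G F, relBrauerClass X m ε) :
    ∃ c : Cocycle (AbsGal F) (TorusSemidirect X m G (SeparableClosure F)), c.classify = p := by
  obtain ⟨ε, b, hb⟩ := p
  obtain ⟨E, rfl⟩ := Quotient.exists_rep ε
  obtain ⟨γ, hγ, e, he⟩ := exists_equiv_twistFun (L := SeparableClosure F) E
  have hE : (Quotient.mk (galoisIso G F) E : GaloisClass G F) =
      GaloisClass.mk (galoisAlgebraOfHom γ hγ) :=
    Quotient.sound ⟨e, fun g x => Subtype.ext (funext fun h => he g x h)⟩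
  obtain ⟨A, rfl, hA, hA'⟩ : b ∈ relBrauer m F (twistFun X γ) := by
    rw [← relBrauer_congr m F (assocAlgebraTwistEquiv X γ hγ)]
    rwa [hE] at hb
  obtain ⟨c, rfl, k, l, hk, hl, ⟨i⟩⟩ := exists_twistMatrix_equiv hm hγ hA hA'
  refine ⟨c, Sigma.subtype_ext hE.symm ?_⟩
  exact Quotient.sound (IsBrauerEquivalent.symm ⟨k, l, hk, hl, ⟨i.trans c.csaEquiv.symm.mapMatrix⟩⟩)

end Cocycle

/-- For a simply transitive action, evaluation at a point identifies `Map_G(X, E)` with `E`. -/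
def assocAlgebraEvalEquiv (h : ∀ x y : X, ∃! g : G, g • x = y) (x : X) (E : GaloisAlgebra G F) :
    assocAlgebra X E ≃ₐ[F] E :=
  AlgEquiv.ofBijective
    ((Pi.evalAlgHom F (fun _ : X => (E : Type u)) x).comp (assocAlgebra X E).val) <| by
    choose s hs hs' using h x
    refine ⟨fun φ ψ hφ => Subtype.ext (funext fun y => ?_), fun a =>
      ⟨⟨fun y => s y • a, fun g y => ?_⟩, ?_⟩⟩
    · rw [← hs y]
      exact ((φ.2 (s y) x).trans (congrArg (s y • ·) hφ)).trans (ψ.2 (s y) x).symm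
    · beta_reduce
      rw [← hs' (g • y) (g * s y) ((mul_smul g (s y) x).trans (congrArg (g • ·) (hs y))), mul_smul]
    · change s x • a = a
      rw [← hs' x 1 (one_smul G x), one_smul]

variable [Fintype X] [DecidableEq X] [Nonempty X] [Finite G]

/-- The Galois algebra and the Brauer class attached to a cohomology class. -/
def H1.classify : H1 (AbsGal F) (TorusSemidirect X m G (SeparableClosure F)) →
    Σ ε : GaloisClass G F, relBrauerClass X m ε :=
  Quotient.lift (fun c => c.classify) fun c c' h => by
    obtain ⟨a, ha⟩ := h
    refine Sigma.subtype_ext (Cocycle.mk_galois_eq a ha) ?_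
    exact Quotient.sound (Cocycle.csa_isBrauerEquivalent a ha)

/-- The classification of `H¹(F, T ⋊ G)` by Galois algebras and relative Brauer classes. -/
def h1Equiv (hm : (m : SeparableClosure F) ≠ 0) :
    H1 (AbsGal F) (TorusSemidirect X m G (SeparableClosure F)) ≃
      Σ ε : GaloisClass G F, relBrauerClass X m ε :=
  Equiv.ofBijective H1.classify
    ⟨fun x y => Quotient.inductionOn₂ x y fun _ _ h =>
        Quotient.sound (Cocycle.cohomologous_of_classify_eq hm h),
      fun p => let ⟨c, hc⟩ := Cocycle.exists_classify_eq hm p; ⟨H1.mk c, hc⟩⟩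

end Classification

end TorusBrauer

end

theorem lemma5p1_general (F : Type u) [Field F] (m : ℕ) (hm : (m : F) ≠ 0) (G : Type) [Group G]
    [Finite G] (X : Type v) [Fintype X] [DecidableEq X] [Nonempty X] [MulAction G X] :
    (∃ Φ : H1 (AbsGal F) (TorusSemidirect X m G (SeparableClosure F)) ≃
        Σ ε : GaloisClass G F, relBrauerClass X m ε,
      ∀ c : Cocycle (AbsGal F) (TorusSemidirect X m G (SeparableClosure F)),
        (∃ (E : GaloisAlgebra G F) (e : E ≃ₐ[F] twistGalois c),
          (∀ (g : G) (x : E) (h : G), (e (g • x)).1 h = (e x).1 (h * g)) ∧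
          (Φ (H1.mk c)).1 = GaloisClass.mk E) ∧
        (∃ A : CSA.{u, u} F, Nonempty (A ≃ₐ[F] twistMatrix c) ∧
          ((Φ (H1.mk c)).2 : BrauerGroup.{u, u} F) = Quotient.mk (Brauer.CSA_Setoid F) A)) ∧
    ((∀ x y : X, ∃! g : G, g • x = y) → ∀ E : GaloisAlgebra G F,
      relBrauerClass X m (GaloisClass.mk E) = relBrauer m F E) := by
  have hm' : (m : SeparableClosure F) ≠ 0 := by
    rw [← map_natCast (algebraMap F (SeparableClosure F))]
    exact (map_ne_zero _).2 hm
  refine ⟨⟨h1Equiv hm', fun c => ⟨⟨c.galois, AlgEquiv.refl, fun _ _ _ => rfl, rfl⟩,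
    c.csa, ⟨c.csaEquiv⟩, rfl⟩⟩, fun h E => ?_⟩
  obtain ⟨x⟩ := ‹Nonempty X›
  exact relBrauer_congr m F (assocAlgebraEvalEquiv h x E)

theorem lemma5p1 (F : Type u) [Field F] (n m : ℕ) (hn : 2 ≤ n) (hm : m ∣ n)
    (hchar : ¬ ringChar F ∣ n) (G : Subgroup (Equiv.Perm (Fin n)))
    (X : Type v) [Fintype X] [DecidableEq X] [MulAction G X] (hX : Fintype.card X = n) :
    (∃ Φ : H1 (AbsGal F) (TorusSemidirect X m G (SeparableClosure F)) ≃
        Σ ε : GaloisClass G F, relBrauerClass X m ε,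
      ∀ c : Cocycle (AbsGal F) (TorusSemidirect X m G (SeparableClosure F)),
        (∃ (E : GaloisAlgebra G F) (e : E ≃ₐ[F] twistGalois c),
          (∀ (g : G) (x : E) (h : G), (e (g • x)).1 h = (e x).1 (h * g)) ∧
          (Φ (H1.mk c)).1 = GaloisClass.mk E) ∧
        (∃ A : CSA.{u, u} F, Nonempty (A ≃ₐ[F] twistMatrix c) ∧
          ((Φ (H1.mk c)).2 : BrauerGroup.{u, u} F) = Quotient.mk (Brauer.CSA_Setoid F) A)) ∧
    ((∀ x y : X, ∃! g : G, g • x = y) → ∀ E : GaloisAlgebra G F,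
      relBrauerClass X m (GaloisClass.mk E) = relBrauer m F E) := by
  have : Nonempty X := Fintype.card_pos_iff.1 (by lia)
  exact lemma5p1_general F m (fun h => hchar ((ringChar.dvd h).trans hm)) G X
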